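/- **Setting.** Consider $N$ spins-1/2 on a chain with sites $1,\dots,N$, and let $\|\cdot\|$ be the operator norm. Fix $\xi>0$ and $q$. A unitary $U$ is *quasilocal* (with parameters $\xi,q$) if $$U=\prod_{n=1}^{N}\prod_{j=1}^{n}\prod_{i=0}^{\lfloor (N-n)/n\rfloor}U^{(n)}_{in+j},$$ with the factors multiplied with the indices increasing either from left to right or from right to left, where $U^{(n)}_k$ is a unitary acting on sites $k,\dots,k+n-1$ (if $k+n-1>N$: a tensor product of a unitary on sites $k,\dots,N$ and a unitary on sites $1,\dots,k+n-1-N$) with $\|\mathbb 1-U^{(n)}_k\|^2<q\,e^{-(n-1)/\xi}$. A Hamiltonian $H$ is *MBL* (with localization length $\xi$ and constant $q$) if, for some such $U$ and $\tau^z_i=U\sigma^z_iU^\dagger$, $$H=\sum_{p\ge1}\ \sum_{i_1<\dots<i_p}J_{i_1\dots i_p}\,\tau^z_{i_1}\cdots\tau^z_{i_p},\qquad J_{i_1\dots i_p}\in\mathbb R,\quad |J_{i_1\dots i_p}|\le e^{-(i_p-i_1)/\xi}.$$ The *$\epsilon$-approximate circuit complexity* $C_\epsilon(W)$ is the least $k$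 such that $\|G_k\cdots G_1-W\|\le\epsilon$ for some gates $G_1,\dots,G_k$, each a $\mathrm{CNOT}$, a Hadamard gate or a $T=\mathrm{diag}(1,e^{i\pi/4})$ gate applied to some of the $N$ qubits (no ancillas). **Theorem 3 (Sublinear growth of MBL circuit complexity).** Let $0<\xi<1/(4\log 2)$, let $q\in\mathbb R$ and let $\epsilon>0$ be constants. Then there are real polynomials $P,Q$ and a function $g$ with $g(t)=o(t)$ as $t\to\infty$, depending only on $\xi,q,\epsilon$, such that for every $N\ge1$, every MBL Hamiltonian $H$ on $N$ sites with localization length $\xi$ and constant $q$, and every $t>0$, some circuit over $\{\mathrm{CNOT},\mathrm H,T\}$ approximates $e^{-iHt}$ up to error $\epsilon$ and $$C_\epsilon(e^{-iHt})\ \le\ P(N)\,Q(\log(N^2t))\,g(t).$$ Moreover, for each fixed $N$ the right-hand side is $o(t)$ as $t\to\infty$; in particular, the complexity grows sublinearly in $t$. -/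

import Mathlib

open scoped Matrix.Norms.L2Operator

namespace MBL

/-- Computational basis of `N` spins-1/2; `x i = 0` is spin up (`σᶻ = +1`) at site `i`. -/
abbrev Basis (N : ℕ) : Type := Fin N → Fin 2

/-- Operators on the `N`-spin Hilbert space, as matrices in the computational basis.
The norm on these matrices is the (ℓ²) operator norm, i.e. the largest singular value. -/
abbrev Op (N : ℕ) : Type := Matrix (Basis N) (Basis N) ℂ

/-- The Pauli operator `σᶻ` at site `i`. -/
def sigmaZ {N : ℕ} (i : Fin N) : Op N :=
  Matrix.diagonal fun x => if x i = 0 then 1 else -1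

/-- `A` acts on the sites in `S`: it is `B ⊗ 𝟙` for an operator `B` on the spins in `S`. -/
def ActsOn {N : ℕ} (S : Finset (Fin N)) (A : Op N) : Prop :=
  ∃ B : Matrix (S → Fin 2) (S → Fin 2) ℂ, ∀ x y : Basis N,
    A x y = if ∀ i, i ∉ S → x i = y i then B (fun i => x i) (fun i => y i) else 0

/-- The sites `a, a + 1, …, b` of the chain, where sites are numbered `1, …, N`
(site number `s` is the index `s - 1` of `Fin N`). -/
def sites (N a b : ℕ) : Finset (Fin N) :=
  Finset.univ.filter fun s => a ≤ s.val + 1 ∧ s.val + 1 ≤ b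

/-- `V` is an admissible constituent `U_k^{(n)}`: a unitary acting on sites
`k, …, k + n - 1`; if this range exceeds the chain, a tensor product of a unitary on sites
`k, …, N` and a unitary on sites `1, …, k + n - 1 - N`. Moreover it is close to the identity. -/
def IsConstituent {N : ℕ} (ξ q : ℝ) (n k : ℕ) (V : Op N) : Prop :=
  ((k + n - 1 ≤ N ∧ V ∈ Matrix.unitaryGroup (Basis N) ℂ ∧ ActsOn (sites N k (k + n - 1)) V) ∨
    (N < k + n - 1 ∧ ∃ A B : Op N,
      A ∈ Matrix.unitaryGroup (Basis N) ℂ ∧ ActsOn (sites N k N) A ∧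
      B ∈ Matrix.unitaryGroup (Basis N) ℂ ∧ ActsOn (sites N 1 (k + n - 1 - N)) B ∧
      V = A * B)) ∧
  ‖(1 : Op N) - V‖ ^ 2 < q * Real.exp (-((n : ℝ) - 1) / ξ)

/-- The factors `V n (i * n + j)`, listed in the order of the nested product
over `n = 1, …, N`, then `j = 1, …, n`, then `i = 0, …, ⌊(N - n) / n⌋`. -/
def factors {N : ℕ} (V : ℕ → ℕ → Op N) : List (Op N) :=
  (List.range' 1 N).flatMap fun n =>
    (List.range' 1 n).flatMap fun j =>
      (List.range ((N - n) / n + 1)).map fun i => V n (i * n + j)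

/-- Quasilocal unitaries on a chain of `N` sites, with localization length `ξ` and constant `q`.
The product sign for noncommuting factors is read in either of the two usual ways
(indices increasing from left to right, or from right to left); both are admitted. -/
def IsQuasilocal {N : ℕ} (ξ q : ℝ) (U : Op N) : Prop :=
  ∃ V : ℕ → ℕ → Op N,
    (∀ n j i : ℕ, 1 ≤ n → n ≤ N → 1 ≤ j → j ≤ n → i ≤ (N - n) / n →
      IsConstituent ξ q n (i * n + j) (V n (i * n + j))) ∧
    (U = (factors V).prod ∨ U = (factors V).reverse.prod)

/-- The local integral of motion `τᶻ_i = U σᶻ_i U†`. -/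
def tauZ {N : ℕ} (U : Op N) (i : Fin N) : Op N :=
  U * sigmaZ i * U.conjTranspose

/-- The product `τᶻ_{i₁} ⋯ τᶻ_{i_p}` for `I = {i₁ < ⋯ < i_p}`. -/
def tauProd {N : ℕ} (U : Op N) (I : Finset (Fin N)) : Op N :=
  ((I.sort (· ≤ ·)).map (tauZ U)).prod

/-- `H` is an MBL Hamiltonian with localization length `ξ` and constant `q`:
`H = ∑_I J_I τᶻ_I` over nonempty sets `I` of sites, with real couplings satisfying
`|J_{i₁…i_p}| ≤ exp (-(i_p - i₁) / ξ)` and with `τᶻ_i = U σᶻ_i U†`, `U` quasilocal. -/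
def IsMBL {N : ℕ} (ξ q : ℝ) (H : Op N) : Prop :=
  ∃ (U : Op N) (J : Finset (Fin N) → ℝ),
    IsQuasilocal ξ q U ∧
    (∀ (I : Finset (Fin N)) (hI : I.Nonempty),
      |J I| ≤ Real.exp (-(((I.max' hI).val : ℝ) - ((I.min' hI).val : ℝ)) / ξ)) ∧
    H = ∑ I ∈ Finset.univ.filter (fun I : Finset (Fin N) => I.Nonempty),
      (J I : ℂ) • tauProd U I

/-- The gates Hadamard, `T` and `CNOT` placed on a register of `N` qubits. -/
inductive Gate (N : ℕ) : Type
  | hadamard (i : Fin N) : Gate N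
  | phaseT (i : Fin N) : Gate N
  | cnot (control target : Fin N) (hne : control ≠ target) : Gate N

/-- The one-qubit operator `g` applied to qubit `i`. -/
def onQubit {N : ℕ} (i : Fin N) (g : Matrix (Fin 2) (Fin 2) ℂ) : Op N :=
  Matrix.of fun x y => if ∀ j, j ≠ i → x j = y j then g (x i) (y i) else 0

/-- The Hadamard matrix. -/
noncomputable def hadamardMatrix : Matrix (Fin 2) (Fin 2) ℂ :=
  (((Real.sqrt 2)⁻¹ : ℝ) : ℂ) • !![1, 1; 1, -1]

/-- The `π/8`-phase gate `T = diag(1, e^{iπ/4})`. -/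
noncomputable def tMatrix : Matrix (Fin 2) (Fin 2) ℂ :=
  !![1, 0; 0, Complex.exp (Complex.I * (Real.pi / 4 : ℝ))]

/-- The unitary implemented by a gate. -/
noncomputable def Gate.toOp {N : ℕ} : Gate N → Op N
  | .hadamard i => onQubit i hadamardMatrix
  | .phaseT i => onQubit i tMatrix
  | .cnot c t _ =>
      Matrix.of fun x y => if x = Function.update y t (y t + y c) then 1 else 0

/-- The unitary `G_k ⋯ G_2 G_1` of the circuit `[G_1, G_2, …, G_k]`. -/
noncomputable def circuitOp {N : ℕ} (G : List (Gate N)) : Op N :=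
  (G.map Gate.toOp).reverse.prod

/-- The sizes of the circuits that approximate `W` up to error `ε` in operator norm. -/
def approxSizes {N : ℕ} (ε : ℝ) (W : Op N) : Set ℕ :=
  {k | ∃ G : List (Gate N), G.length = k ∧ ‖circuitOp G - W‖ ≤ ε}

/-- The `ε`-approximate circuit complexity `C_ε(W)`, the least element of `approxSizes ε W`
(meaningful when that set is nonempty). -/
noncomputable def circuitComplexity {N : ℕ} (ε : ℝ) (W : Op N) : ℕ :=
  sInf (approxSizes ε W)

/-- The time evolution operator `e^{-iHt}`. -/
noncomputable def evolution {N : ℕ} (H : Op N) (t : ℝ) : Op N :=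
  NormedSpace.exp ((-(Complex.I * (t : ℂ))) • H)

end MBL

/-! Conjugation by the time-independent unitary `U` diagonalises the Hamiltonian: e^{-iHt} = U D_t
U†, where D_t is a product of commuting rotations exp(-itJ_I ∏_{i∈I} σᶻ_i). Circuits for `U` and U†
are a fixed cost, polynomial in N, so the growth in t comes from D_t alone.

For D_t (`approx_diagEvolution`), the bound on ξ gives e^{-m/ξ} ≤ 16^{-m}, while at most N·2^{s+1}
sets have width s. The couplings of width above k therefore have total strength O(N·8^{-k}), and
dropping them is harmless once 8^k is of order Nt/δ. At most M = N·2^{k+1} rotations remain, each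
needed to accuracy of order δ/M. If accuracy η costs O(1/η) gates, the total is of order M²/δ, hence
of order 4^k = (8^k)^{2/3} in t. So g(t) = (1+t)^{2/3} works, and no logarithmic factor is needed.

The crude cost O(1/η) for one qubit follows from the group-commutator step of Solovay and Kitaev
(`exists_word_length_le`), applied to unit quaternions. It needs H and T to generate a dense set of
rotations: two explicit words turn by an angle incommensurable with 2π about different axes
(`mem_of_generators`).

For `U` (`approxPhase_of_quasilocal`), constituents on more than about log₄(N²/δ) sites are replaced
by the identity. The others act on spaces of dimension polynomial in N; each is the exponential of a
sum of Pauli strings, which is Trotterised (`approx_of_actsOn`). This determines `U` only up to a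
phase, which cancels between `U` and U†. -/

open scoped Quaternion

namespace MBL

/-! ### Tensor products and one-qubit operators -/

section Tensor
variable {ι : Type*} [Fintype ι]

/-- The tensor product of one-spin operators. -/
def tens (f : ι → Matrix (Fin 2) (Fin 2) ℂ) : Matrix (ι → Fin 2) (ι → Fin 2) ℂ :=
  Matrix.of fun x y => ∏ i, f i (x i) (y i)

theorem tens_mul [DecidableEq ι] (f g : ι → Matrix (Fin 2) (Fin 2) ℂ) :
    tens f * tens g = tens (fun i => f i * g i) := by
  ext x y
  simp only [Matrix.mul_apply, tens, Matrix.of_apply, Finset.prod_univ_sum,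
    Fintype.piFinset_univ, Finset.prod_mul_distrib]

theorem tens_one [DecidableEq ι] :
    tens (fun _ : ι => (1 : Matrix (Fin 2) (Fin 2) ℂ)) = 1 := by
  ext x y
  simp only [tens, Matrix.of_apply, Matrix.one_apply]
  rw [Fintype.prod_ite_zero]
  simp [funext_iff]

theorem tens_conjTranspose (f : ι → Matrix (Fin 2) (Fin 2) ℂ) :
    (tens f).conjTranspose = tens (fun i => (f i).conjTranspose) := by
  ext x y
  simp [tens]

end Tensor

theorem onQubit_eq_tens {N : ℕ} (i : Fin N) (g : Matrix (Fin 2) (Fin 2) ℂ) :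
    onQubit i g = tens (Function.update 1 i g) := by
  ext x y
  simp only [onQubit, tens, Matrix.of_apply]
  rw [← Finset.mul_prod_erase _ _ (Finset.mem_univ i), Function.update_self]
  have : ∀ j ∈ Finset.univ.erase i, (Function.update 1 i g : Fin N → Matrix (Fin 2) (Fin 2) ℂ) j
      (x j) (y j) = if x j = y j then 1 else 0 := by
    intro j hj
    rw [Function.update_of_ne (Finset.ne_of_mem_erase hj)]
    simp [Matrix.one_apply]
  rw [Finset.prod_congr rfl this, Finset.prod_ite_zero]
  simp

theorem onQubit_mul {N : ℕ} (i : Fin N) (g h : Matrix (Fin 2) (Fin 2) ℂ) :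
    onQubit i g * onQubit i h = onQubit i (g * h) := by
  simp only [onQubit_eq_tens, tens_mul]
  congr 1
  ext1 j
  rcases eq_or_ne j i with rfl | h <;> simp [*]

theorem onQubit_one {N : ℕ} (i : Fin N) : onQubit i (1 : Matrix (Fin 2) (Fin 2) ℂ) = 1 := by
  rw [onQubit_eq_tens, ← tens_one]
  congr 1
  exact Function.update_eq_self i 1

theorem onQubit_conjTranspose {N : ℕ} (i : Fin N) (g : Matrix (Fin 2) (Fin 2) ℂ) :
    (onQubit i g).conjTranspose = onQubit i g.conjTranspose := by
  simp only [onQubit_eq_tens, tens_conjTranspose]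
  congr 1
  ext1 j
  rcases eq_or_ne j i with rfl | h <;> simp [*]

theorem onQubit_pow {N : ℕ} (i : Fin N) (g : Matrix (Fin 2) (Fin 2) ℂ) (n : ℕ) :
    onQubit i g ^ n = onQubit i (g ^ n) := by
  induction n with
  | zero => simp [onQubit_one]
  | succ n ih => rw [pow_succ, ih, onQubit_mul, pow_succ]

theorem onQubit_sub {N : ℕ} (i : Fin N) (g h : Matrix (Fin 2) (Fin 2) ℂ) :
    onQubit i g - onQubit i h = onQubit i (g - h) := by
  ext x y
  simp only [onQubit, Matrix.of_apply, Matrix.sub_apply]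
  split_ifs <;> simp

theorem onQubit_smul {N : ℕ} (i : Fin N) (c : ℂ) (g : Matrix (Fin 2) (Fin 2) ℂ) :
    onQubit i (c • g) = c • onQubit i g := by
  ext x y
  simp only [onQubit, Matrix.of_apply, Matrix.smul_apply]
  split_ifs <;> simp

/-! ### The gates, their inverses and circuits -/

theorem exp_pi_div_four :
    Complex.exp (Complex.I * (Real.pi / 4 : ℝ)) = ((√2 / 2 : ℝ) : ℂ) * (1 + Complex.I) := by
  rw [mul_comm, Complex.exp_mul_I, ← Complex.ofReal_cos, ← Complex.ofReal_sin,
    Real.cos_pi_div_four, Real.sin_pi_div_four]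
  ring

theorem ofReal_sqrt_two_sq : ((√2 : ℝ) : ℂ) * ((√2 : ℝ) : ℂ) = 2 := by
  rw [← Complex.ofReal_mul, Real.mul_self_sqrt (by norm_num)]; norm_num

theorem hadamardMatrix_eq : hadamardMatrix = ((√2 / 2 : ℝ) : ℂ) • !![1, 1; 1, -1] := by
  rw [hadamardMatrix]
  congr 2
  have : √2 * √2 = 2 := Real.mul_self_sqrt (by norm_num)
  field_simp
  linarith

theorem hadamardMatrix_conjTranspose : hadamardMatrix.conjTranspose = hadamardMatrix := by
  ext i j
  fin_cases i <;> fin_cases j <;> simp [hadamardMatrix_eq, Matrix.conjTranspose_apply]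

theorem hadamardMatrix_mul_self : hadamardMatrix * hadamardMatrix = 1 := by
  have h := ofReal_sqrt_two_sq
  rw [hadamardMatrix_eq]
  ext i j
  fin_cases i <;> fin_cases j <;> simp [Matrix.mul_apply, Fin.sum_univ_two] <;>
    linear_combination h / 2

theorem tMatrix_conjTranspose_mul_self : tMatrix.conjTranspose * tMatrix = 1 := by
  have h := ofReal_sqrt_two_sq
  rw [tMatrix, exp_pi_div_four]
  ext i j
  fin_cases i <;> fin_cases j <;>
    simp [Matrix.mul_apply, Fin.sum_univ_two, Matrix.conjTranspose_apply, Complex.conj_ofNat]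
  linear_combination h / 2 - (√2 : ℂ) ^ 2 / 4 * Complex.I_sq

theorem tMatrix_pow_eight : tMatrix ^ 8 = 1 := by
  have h : tMatrix = Matrix.diagonal ![1, Complex.exp (Complex.I * (Real.pi / 4 : ℝ))] := by
    rw [tMatrix]
    ext i j
    fin_cases i <;> fin_cases j <;> simp
  rw [h, Matrix.diagonal_pow, ← Matrix.diagonal_one]
  congr 1
  ext i
  fin_cases i
  · simp
  · simp only [Fin.mk_one, Pi.pow_apply, Matrix.cons_val_one, Matrix.cons_val_zero]
    rw [← Complex.exp_nat_mul]
    convert Complex.exp_two_pi_mul_I using 2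
    push_cast; ring

theorem tMatrix_conjTranspose : tMatrix.conjTranspose = tMatrix ^ 7 := by
  calc tMatrix.conjTranspose = tMatrix.conjTranspose * (tMatrix * tMatrix ^ 7) := by
        rw [← pow_succ', tMatrix_pow_eight, mul_one]
    _ = _ := by rw [← mul_assoc, tMatrix_conjTranspose_mul_self, one_mul]

theorem circuitOp_append {N : ℕ} (G G' : List (Gate N)) :
    circuitOp (G ++ G') = circuitOp G' * circuitOp G := by
  simp [circuitOp]

theorem circuitOp_nil {N : ℕ} : circuitOp ([] : List (Gate N)) = 1 := by
  simp [circuitOp]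

theorem circuitOp_singleton {N : ℕ} (g : Gate N) : circuitOp [g] = g.toOp := by
  simp [circuitOp]

theorem circuitOp_replicate {N : ℕ} (g : Gate N) (n : ℕ) :
    circuitOp (List.replicate n g) = g.toOp ^ n := by
  simp [circuitOp]

theorem cnot_involutive {N : ℕ} {c t : Fin N} (h : c ≠ t) (y : Basis N) :
    Function.update (Function.update y t (y t + y c)) t
      ((Function.update y t (y t + y c)) t + (Function.update y t (y t + y c)) c) = y := by
  ext1 j
  rcases eq_or_ne j t with rfl | hj
  · simp only [Function.update_self, Function.update_of_ne h]
    rw [add_assoc]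
    have : ∀ a : Fin 2, a + a = 0 := by decide
    rw [this, add_zero]
  · simp [hj]

/-- The permutation of the basis states performed by a `CNOT`. -/
def cnotPerm {N : ℕ} {c t : Fin N} (h : c ≠ t) : Equiv.Perm (Basis N) where
  toFun y := Function.update y t (y t + y c)
  invFun y := Function.update y t (y t + y c)
  left_inv := cnot_involutive h
  right_inv := cnot_involutive h

theorem cnot_toOp_apply {N : ℕ} {c t : Fin N} (h : c ≠ t) (x y : Basis N) :
    (Gate.cnot c t h).toOp x y = if x = cnotPerm h y then 1 else 0 := rfl

theorem cnot_conjTranspose {N : ℕ} {c t : Fin N} (h : c ≠ t) :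
    (Gate.cnot c t h).toOp.conjTranspose = (Gate.cnot c t h).toOp := by
  ext x y
  rw [Matrix.conjTranspose_apply, cnot_toOp_apply, cnot_toOp_apply]
  have : y = cnotPerm h x ↔ x = cnotPerm h y := by
    constructor
    · rintro rfl; exact (cnot_involutive h x).symm
    · rintro rfl; exact (cnot_involutive h y).symm
  simp only [this]
  split_ifs <;> simp

/-- `CNOT` permutes the computational basis, so conjugation by it only relabels diagonal entries.
This is what turns a rotation about one parity into a rotation about a larger one. -/
theorem cnot_mul_diagonal_mul_cnot {N : ℕ} {c t : Fin N} (h : c ≠ t) (d : Basis N → ℂ) :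
    (Gate.cnot c t h).toOp * Matrix.diagonal d * (Gate.cnot c t h).toOp =
      Matrix.diagonal (d ∘ cnotPerm h) := by
  ext x y
  rw [Matrix.mul_apply]
  simp only [Matrix.mul_diagonal, cnot_toOp_apply]
  rw [Finset.sum_eq_single (cnotPerm h y)]
  · have : cnotPerm h (cnotPerm h y) = y := cnot_involutive h y
    simp only [this, if_true, mul_one, Matrix.diagonal_apply, Function.comp]
    split_ifs with h1
    · simp [h1]
    · simp
  · intro b _ hb
    simp [hb]
  · simp

theorem cnot_mul_self {N : ℕ} {c t : Fin N} (h : c ≠ t) :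
    (Gate.cnot c t h).toOp * (Gate.cnot c t h).toOp = 1 := by
  have := cnot_mul_diagonal_mul_cnot h (fun _ => 1)
  rw [Matrix.diagonal_one, mul_one] at this
  rw [this, ← Matrix.diagonal_one]
  rfl

/-- H and `CNOT` are involutions and T⁸ = 1, so the worst inverse is T⁷. This is the source of every
factor 7 below. -/
theorem Gate.exists_inverse {N : ℕ} (g : Gate N) :
    ∃ G : List (Gate N), G.length ≤ 7 ∧ circuitOp G = g.toOp.conjTranspose := by
  cases g with
  | hadamard i =>
    refine ⟨[.hadamard i], by simp, ?_⟩
    rw [circuitOp_singleton, Gate.toOp, onQubit_conjTranspose, hadamardMatrix_conjTranspose]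
  | phaseT i =>
    refine ⟨List.replicate 7 (.phaseT i), by simp, ?_⟩
    rw [circuitOp_replicate, Gate.toOp, onQubit_conjTranspose, tMatrix_conjTranspose, onQubit_pow]
  | cnot c t h =>
    refine ⟨[.cnot c t h], by simp, ?_⟩
    rw [circuitOp_singleton, cnot_conjTranspose]

theorem Gate.conjTranspose_mul_self {N : ℕ} (g : Gate N) : g.toOp.conjTranspose * g.toOp = 1 := by
  cases g with
  | hadamard i =>
    rw [Gate.toOp, onQubit_conjTranspose, onQubit_mul, hadamardMatrix_conjTranspose,
      hadamardMatrix_mul_self, onQubit_one]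
  | phaseT i =>
    rw [Gate.toOp, onQubit_conjTranspose, onQubit_mul, tMatrix_conjTranspose_mul_self, onQubit_one]
  | cnot c t h => rw [cnot_conjTranspose, cnot_mul_self]

theorem circuitOp_mem_unitary {N : ℕ} (G : List (Gate N)) : circuitOp G ∈ unitary (Op N) := by
  rw [circuitOp]
  apply Submonoid.list_prod_mem
  intro x hx
  simp only [List.mem_reverse, List.mem_map] at hx
  obtain ⟨g, -, rfl⟩ := hx
  have := g.conjTranspose_mul_self
  exact ⟨this, mul_eq_one_comm.mp this⟩

theorem exists_inverse_circuit {N : ℕ} (G : List (Gate N)) :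
    ∃ G' : List (Gate N), G'.length ≤ 7 * G.length ∧
      circuitOp G' = (circuitOp G).conjTranspose := by
  induction G with
  | nil => exact ⟨[], by simp, by simp [circuitOp_nil]⟩
  | cons g G ih =>
    obtain ⟨G', hl, hG'⟩ := ih
    obtain ⟨G₁, hl₁, hG₁⟩ := g.exists_inverse
    refine ⟨G' ++ G₁, by simp; omega, ?_⟩
    have : circuitOp (g :: G) = circuitOp G * g.toOp := by
      rw [← circuitOp_singleton, ← circuitOp_append]; rfl
    rw [circuitOp_append, this, Matrix.conjTranspose_mul, hG', hG₁]

/-! ### Approximation by circuits: adding errors and sizes -/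

theorem norm_le_one_of_mem_unitary {n : Type*} [Fintype n] [DecidableEq n] {W : Matrix n n ℂ}
    (hW : W ∈ unitary (Matrix n n ℂ)) : ‖W‖ ≤ 1 := by
  have h : ‖W‖ * ‖W‖ = ‖(1 : Matrix n n ℂ)‖ := by rw [← CStarRing.norm_star_mul_self, hW.1]
  have h1 : ‖(1 : Matrix n n ℂ)‖ ≤ 1 := by
    rw [← Matrix.diagonal_one, Matrix.l2_opNorm_diagonal]
    exact (pi_norm_le_iff_of_nonneg zero_le_one).2 fun _ => by simp
  nlinarith [norm_nonneg W]

/-- Some circuit of size at most `L` approximates `W` up to error `δ`. -/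
def Approx {N : ℕ} (δ L : ℝ) (W : Op N) : Prop :=
  ∃ G : List (Gate N), (G.length : ℝ) ≤ L ∧ ‖circuitOp G - W‖ ≤ δ

namespace Approx
variable {N : ℕ} {δ δ' L L' : ℝ} {W W' : Op N}

theorem mono (h : Approx δ L W) (hδ : δ ≤ δ') (hL : L ≤ L') : Approx δ' L' W := by
  obtain ⟨G, h1, h2⟩ := h
  exact ⟨G, h1.trans hL, h2.trans hδ⟩

theorem of_circuit (G : List (Gate N)) : Approx 0 G.length (circuitOp G) :=
  ⟨G, le_rfl, by simp⟩

theorem one : Approx 0 0 (1 : Op N) := ⟨[], by simp, by simp [circuitOp_nil]⟩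

/-- Errors add without amplification because the circuit operator is exactly unitary; of the
targets, only the right factor needs a norm bound. -/
theorem mul (h : Approx δ L W) (h' : Approx δ' L' W') (hW' : ‖W'‖ ≤ 1) :
    Approx (δ + δ') (L + L') (W * W') := by
  obtain ⟨G, h1, h2⟩ := h
  obtain ⟨G', h1', h2'⟩ := h'
  refine ⟨G' ++ G, by push_cast [List.length_append]; linarith, ?_⟩
  rw [circuitOp_append]
  calc ‖circuitOp G * circuitOp G' - W * W'‖
      = ‖circuitOp G * (circuitOp G' - W') + (circuitOp G - W) * W'‖ := by congr 1; noncomm_ring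
    _ ≤ ‖circuitOp G‖ * ‖circuitOp G' - W'‖ + ‖circuitOp G - W‖ * ‖W'‖ :=
        (norm_add_le _ _).trans (add_le_add (norm_mul_le _ _) (norm_mul_le _ _))
    _ ≤ 1 * δ' + δ * 1 := by
        have := norm_le_one_of_mem_unitary (circuitOp_mem_unitary G)
        gcongr
        exact (norm_nonneg _).trans h2
    _ = δ + δ' := by ring

theorem conjTranspose (h : Approx δ L W) : Approx δ (7 * L) W.conjTranspose := by
  obtain ⟨G, h1, h2⟩ := h
  obtain ⟨G', h1', h2'⟩ := exists_inverse_circuit G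
  refine ⟨G', ?_, ?_⟩
  · have : (G'.length : ℝ) ≤ 7 * G.length := by exact_mod_cast h1'
    linarith
  · rwa [h2', ← Matrix.conjTranspose_sub, Matrix.l2_opNorm_conjTranspose]

theorem of_norm_sub_le (h : Approx δ L W) (hW : ‖W - W'‖ ≤ δ') : Approx (δ + δ') L W' := by
  obtain ⟨G, h1, h2⟩ := h
  refine ⟨G, h1, ?_⟩
  calc ‖circuitOp G - W'‖ = ‖(circuitOp G - W) + (W - W')‖ := by congr 1; abel
    _ ≤ _ := (norm_add_le _ _).trans (add_le_add h2 hW)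

theorem list_prod (l : List (Op N)) (h : ∀ W ∈ l, Approx δ L W) (h1 : ∀ W ∈ l, W ∈ unitary (Op N)) :
    Approx (l.length * δ) (l.length * L) l.prod := by
  induction l with
  | nil => simpa using one
  | cons W l ih =>
    rw [List.forall_mem_cons] at h h1
    have hp := norm_le_one_of_mem_unitary (Submonoid.list_prod_mem _ h1.2)
    refine ((h.1.mul (ih h.2 h1.2) hp)).mono ?_ ?_ <;> (push_cast [List.length_cons]; linarith)

end Approx

/-! ### A weak Solovay–Kitaev theorem for unit quaternions -/

section Quaternion

/-- The quaternion with given coordinates. -/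
def quat (a b c d : ℝ) : ℍ[ℝ] := ⟨a, b, c, d⟩

@[simp] theorem quat_re (a b c d : ℝ) : (quat a b c d).re = a := rfl
@[simp] theorem quat_imI (a b c d : ℝ) : (quat a b c d).imI = b := rfl
@[simp] theorem quat_imJ (a b c d : ℝ) : (quat a b c d).imJ = c := rfl
@[simp] theorem quat_imK (a b c d : ℝ) : (quat a b c d).imK = d := rfl

theorem quaternion_mul_star {q : ℍ[ℝ]} (h : ‖q‖ = 1) : q * star q = 1 := by
  rw [Quaternion.self_mul_star, Quaternion.normSq_eq_norm_mul_self, h]; simp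

theorem quaternion_star_mul {q : ℍ[ℝ]} (h : ‖q‖ = 1) : star q * q = 1 := by
  rw [Quaternion.star_mul_self, Quaternion.normSq_eq_norm_mul_self, h]; simp

theorem quaternion_norm_sq (q : ℍ[ℝ]) :
    ‖q‖ ^ 2 = q.re ^ 2 + q.imI ^ 2 + q.imJ ^ 2 + q.imK ^ 2 := by
  rw [sq, ← Quaternion.normSq_eq_norm_mul_self, Quaternion.normSq_def']

theorem quaternion_norm_eq_one {q : ℍ[ℝ]}
    (h : q.re ^ 2 + q.imI ^ 2 + q.imJ ^ 2 + q.imK ^ 2 = 1) : ‖q‖ = 1 := by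
  rw [← quaternion_norm_sq] at h
  exact (pow_eq_one_iff_of_nonneg (norm_nonneg _) two_ne_zero).1 h

theorem norm_sub_one_sq {q : ℍ[ℝ]} (h : ‖q‖ = 1) : ‖q - 1‖ ^ 2 = 2 * (1 - q.re) := by
  have h1 := quaternion_norm_sq q
  rw [quaternion_norm_sq]
  rw [h] at h1
  simp
  linarith

/-- Quaternions with the same real part and norm are conjugate. -/
theorem exists_conj_of_re_eq {q r : ℍ[ℝ]} (hre : q.re = r.re) (hn : ‖q‖ = ‖r‖) :
    ∃ p : ℍ[ℝ], ‖p‖ = 1 ∧ r = p * q * star p := by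
  have hn' : q.imI ^ 2 + q.imJ ^ 2 + q.imK ^ 2 = r.imI ^ 2 + r.imJ ^ 2 + r.imK ^ 2 := by
    have h1 := quaternion_norm_sq q
    have h2 := quaternion_norm_sq r
    rw [hn, h2, hre] at h1
    linarith
  suffices h : ∃ p : ℍ[ℝ], p ≠ 0 ∧ r * p = p * q by
    obtain ⟨p, hp, h⟩ := h
    have hp' : ‖p‖ ≠ 0 := norm_ne_zero_iff.2 hp
    have hu : ‖(‖p‖⁻¹ • p : ℍ[ℝ])‖ = 1 := by
      rw [norm_smul, norm_inv, norm_norm, inv_mul_cancel₀ hp']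
    refine ⟨‖p‖⁻¹ • p, hu, ?_⟩
    rw [smul_mul_assoc, ← h, ← mul_smul_comm, mul_assoc, quaternion_mul_star hu, mul_one]
  -- Both imaginary parts square to the same real number, so r.im·y + y·q.im intertwines `q` and `r`
  -- for every `y`. A nonzero value for some `y` then gives the conjugator after normalisation.
  have key : ∀ y : ℍ[ℝ], r * (r.im * y + y * q.im) = (r.im * y + y * q.im) * q := by
    intro y
    have h1 : r.im * r.im = q.im * q.im := by
      ext <;> simp <;> linarith
    have h2 : q = ((q.re : ℝ) : ℍ[ℝ]) + q.im := (Quaternion.re_add_im q).symm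
    have h3 : r = ((q.re : ℝ) : ℍ[ℝ]) + r.im := by rw [hre]; exact (Quaternion.re_add_im r).symm
    have h4 : r.im * (r.im * y) = y * q.im * q.im := by
      obtain ⟨t, h5⟩ : ∃ t : ℝ, q.im * q.im = (t : ℍ[ℝ]) := by
        refine ⟨-(q.imI ^ 2 + q.imJ ^ 2 + q.imK ^ 2), ?_⟩
        ext <;> simp only [Quaternion.re_coe, Quaternion.imI_coe, Quaternion.imJ_coe,
          Quaternion.imK_coe] <;> simp <;> ring
      rw [← mul_assoc, h1, mul_assoc y, h5]
      exact Quaternion.coe_commutes _ _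
    have h6 := Quaternion.coe_commutes q.re (r.im * y + y * q.im)
    calc r * (r.im * y + y * q.im)
        = q.re * (r.im * y + y * q.im) + (r.im * (r.im * y) + r.im * y * q.im) := by
          conv_lhs => rw [h3]
          simp only [Quaternion.im_add, Quaternion.im_coe, Quaternion.im_idem, zero_add]
          noncomm_ring
      _ = (r.im * y + y * q.im) * (q.re + q.im) := by
          rw [h4, h6]; noncomm_ring
      _ = _ := by rw [← h2]
  -- If the intertwiner vanishes at y = 1, i, j, then r.im = -q.im commutes with i and j, hence is
  -- zero. In that case r = q and p = 1 intertwines.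
  by_contra hcon
  push Not at hcon
  have hz : ∀ y : ℍ[ℝ], r.im * y + y * q.im = 0 := fun y => by
    by_contra h
    exact hcon _ h (key y)
  have e1 := hz 1
  have e2 := hz (quat 0 1 0 0)
  have e3 := hz (quat 0 0 1 0)
  have hr : r = q := by
    simp only [Quaternion.ext_iff] at e1 e2 e3
    simp at e1 e2 e3
    ext
    · exact hre.symm
    all_goals linarith
  exact hcon 1 one_ne_zero (by rw [hr]; simp)

/-- Unit quaternions are commutators of unit quaternions that are close to `1`. -/
theorem exists_commutator {w : ℍ[ℝ]} (hw : ‖w‖ = 1) :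
    ∃ a b : ℍ[ℝ], ‖a‖ = 1 ∧ ‖b‖ = 1 ∧ ‖a - 1‖ ^ 2 ≤ ‖w - 1‖ ∧ ‖b - 1‖ ^ 2 ≤ ‖w - 1‖ ∧
      a * b * (star a * star b) = w := by
  -- The commutator of c + s·i and c + s·j has real part 1 - 2s⁴, whereas w has real part 1 - ‖w -
  -- 1‖²/2; this choice of `s` equates them. Conjugating the pair then yields `w` itself and
  -- preserves distances to 1.
  set s : ℝ := √(‖w - 1‖ / 2) with hs
  have hs2 : s ^ 2 = ‖w - 1‖ / 2 := Real.sq_sqrt (by positivity)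
  have hs0 : 0 ≤ s := Real.sqrt_nonneg _
  have hle : ‖w - 1‖ ≤ 2 := by
    calc ‖w - 1‖ ≤ ‖w‖ + ‖(1 : ℍ[ℝ])‖ := norm_sub_le _ _
      _ = 2 := by rw [hw, norm_one]; norm_num
  set c : ℝ := √(1 - s ^ 2) with hc
  have hc2 : c ^ 2 = 1 - s ^ 2 := Real.sq_sqrt (by linarith)
  have hc0 : 0 ≤ c := Real.sqrt_nonneg _
  have hc1 : c ≤ 1 := by nlinarith
  let a : ℍ[ℝ] := quat c s 0 0
  let b : ℍ[ℝ] := quat c 0 s 0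
  have ha : ‖a‖ = 1 := quaternion_norm_eq_one (by simp [a]; linarith)
  have hb : ‖b‖ = 1 := quaternion_norm_eq_one (by simp [b]; linarith)
  have hre : (a * b * (star a * star b)).re = w.re := by
    have h1 := norm_sub_one_sq hw
    have h2 : (a * b * (star a * star b)).re = 1 - 2 * s ^ 4 := by
      simp [a, b]
      linear_combination (c ^ 2 + 1 + s ^ 2) * hc2
    rw [h2]
    have : s ^ 4 = ‖w - 1‖ ^ 2 / 4 := by rw [show s ^ 4 = (s ^ 2) ^ 2 by ring, hs2]; ring
    linarith
  obtain ⟨p, hp, hpw⟩ := exists_conj_of_re_eq hre (by simp [ha, hb, hw])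
  have hnc : ∀ x : ℍ[ℝ], ‖p * x * star p - 1‖ = ‖x - 1‖ := by
    intro x
    have : p * x * star p - 1 = p * (x - 1) * star p := by
      rw [mul_sub, sub_mul, mul_one, quaternion_mul_star hp]
    rw [this, norm_mul, norm_mul, Quaternion.norm_star, hp]; ring
  refine ⟨p * a * star p, p * b * star p, by simp [hp, ha], by simp [hp, hb], ?_, ?_, ?_⟩
  · rw [hnc, norm_sub_one_sq ha]
    simp only [a, quat_re]
    nlinarith
  · rw [hnc, norm_sub_one_sq hb]
    simp only [b, quat_re]
    nlinarith
  · rw [hpw]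
    simp only [star_mul, star_star]
    have h := quaternion_star_mul hp
    calc p * a * star p * (p * b * star p) * (p * (star a * star p) * (p * (star b * star p)))
        = p * a * (star p * p) * b * (star p * p) * star a * (star p * p) * star b * star p := by
          noncomm_ring
      _ = _ := by rw [h]; noncomm_ring

/-- A commutator equals 1 + (ab - ba)·a*b*, and ab - ba is unchanged when 1 is subtracted from both
entries. An error η in the entries is therefore multiplied by their distance ρ to 1, up to η²; this
gain drives the iteration. -/
theorem norm_commutator_sub_le {a b a₀ b₀ : ℍ[ℝ]} (ha : ‖a‖ = 1) (hb : ‖b‖ = 1)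
    (ha₀ : ‖a₀‖ = 1) (hb₀ : ‖b₀‖ = 1) {η ρ : ℝ} (ha1 : ‖a - 1‖ ≤ ρ) (hb1 : ‖b - 1‖ ≤ ρ)
    (hae : ‖a₀ - a‖ ≤ η) (hbe : ‖b₀ - b‖ ≤ η) :
    ‖a₀ * b₀ * (star a₀ * star b₀) - a * b * (star a * star b)‖ ≤
      4 * ρ ^ 2 * η + 4 * η * ρ + 2 * η ^ 2 := by
  have hη : 0 ≤ η := (norm_nonneg _).trans hae
  have hρ : 0 ≤ ρ := (norm_nonneg _).trans ha1
  have hcomm : ∀ x y : ℍ[ℝ], ‖x * y - y * x‖ ≤ 2 * (‖x‖ * ‖y‖) := fun x y => by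
    calc _ ≤ ‖x * y‖ + ‖y * x‖ := norm_sub_le _ _
      _ = _ := by rw [norm_mul, norm_mul]; ring
  have hk : ‖a * b - b * a‖ ≤ 2 * ρ ^ 2 := by
    have : a * b - b * a = (a - 1) * (b - 1) - (b - 1) * (a - 1) := by noncomm_ring
    rw [this]
    refine (hcomm _ _).trans ?_
    rw [sq]; gcongr
  have hk0 : ‖(a₀ * b₀ - b₀ * a₀) - (a * b - b * a)‖ ≤ 4 * η * ρ + 2 * η ^ 2 := by
    have : (a₀ * b₀ - b₀ * a₀) - (a * b - b * a) =
        ((a₀ - a) * (b₀ - 1) - (b₀ - 1) * (a₀ - a)) +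
          ((a - 1) * (b₀ - b) - (b₀ - b) * (a - 1)) := by noncomm_ring
    rw [this]
    have hb₁ : ‖b₀ - 1‖ ≤ η + ρ := by
      calc ‖b₀ - 1‖ = ‖(b₀ - b) + (b - 1)‖ := by congr 1; abel
        _ ≤ _ := (norm_add_le _ _).trans (add_le_add hbe hb1)
    calc _ ≤ 2 * (‖a₀ - a‖ * ‖b₀ - 1‖) + 2 * (‖a - 1‖ * ‖b₀ - b‖) :=
          (norm_add_le _ _).trans (add_le_add (hcomm _ _) (hcomm _ _))
      _ ≤ 2 * (η * (η + ρ)) + 2 * (ρ * η) := by gcongr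
      _ = _ := by ring
  have hu : ‖star a₀ * star b₀ - star a * star b‖ ≤ 2 * η := by
    have : star a₀ * star b₀ - star a * star b =
        star (a₀ - a) * star b₀ + star a * star (b₀ - b) := by
      simp only [star_sub]; noncomm_ring
    rw [this]
    refine (norm_add_le _ _).trans ?_
    simp only [norm_mul, Quaternion.norm_star, hb₀, ha]
    linarith
  have e : ∀ x y : ℍ[ℝ], ‖x‖ = 1 → ‖y‖ = 1 →
      x * y * (star x * star y) = 1 + (x * y - y * x) * (star x * star y) := by
    intro x y hx hy
    have : y * x * (star x * star y) = 1 := by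
      rw [mul_assoc, ← mul_assoc x, quaternion_mul_star hx, one_mul, quaternion_mul_star hy]
    rw [sub_mul, this]; abel
  rw [e _ _ ha₀ hb₀, e _ _ ha hb]
  calc _ = ‖((a₀ * b₀ - b₀ * a₀) - (a * b - b * a)) * (star a₀ * star b₀) +
        (a * b - b * a) * (star a₀ * star b₀ - star a * star b)‖ := by congr 1; noncomm_ring
    _ ≤ (4 * η * ρ + 2 * η ^ 2) * 1 + (2 * ρ ^ 2) * (2 * η) := by
        refine (norm_add_le _ _).trans (add_le_add ?_ ?_)
        · rw [norm_mul]
          simp only [norm_mul, Quaternion.norm_star, hb₀, ha₀, mul_one]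
          exact hk0
        · rw [norm_mul]; gcongr
    _ = _ := by ring

/-- A weak form of the Solovay–Kitaev theorem for unit quaternions: an increasing family that is
compatible with products and inverses and has dense union approximates with word length `O(1/δ)`. -/
theorem exists_word_length_le (Γ : ℕ → Set ℍ[ℝ]) (hmono : Monotone Γ)
    (hnorm : ∀ n, ∀ a ∈ Γ n, ‖a‖ = 1)
    (hmul : ∀ m n a b, a ∈ Γ m → b ∈ Γ n → a * b ∈ Γ (m + n))
    (hstar : ∀ n a, a ∈ Γ n → star a ∈ Γ (7 * n))
    (hdense : ∀ q : ℍ[ℝ], ‖q‖ = 1 → q ∈ closure (⋃ n, Γ n)) :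
    ∃ C : ℝ, 0 < C ∧ ∀ δ : ℝ, 0 < δ → δ ≤ 1 → ∀ q : ℍ[ℝ], ‖q‖ = 1 →
      ∃ n : ℕ, (n : ℝ) ≤ C / δ ∧ ∃ a ∈ Γ n, ‖a - q‖ ≤ δ := by
  -- With ρ = √ε and η = ε the commutator error is 4ε^{3/2} + 6ε² ≤ 10ε^{3/2}, which is at most ε/17
  -- as soon as √ε ≤ 1/170.
  set ε₀ : ℝ := 1 / 170 ^ 2 with hε₀
  -- Compactness of the unit sphere makes the word length uniform in the target.
  obtain ⟨L, hL⟩ : ∃ L : ℕ, ∀ q : ℍ[ℝ], ‖q‖ = 1 → ∃ a ∈ Γ L, ‖a - q‖ ≤ ε₀ := by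
    have hcomp : IsCompact (Metric.sphere (0 : ℍ[ℝ]) 1) := isCompact_sphere _ _
    obtain ⟨L, hL⟩ := hcomp.elim_directed_cover (fun n => ⋃ a ∈ Γ n, Metric.ball a ε₀)
      (fun n => isOpen_biUnion fun _ _ => Metric.isOpen_ball) (by
        intro q hq
        obtain ⟨a, ha, hd⟩ := Metric.mem_closure_iff.1 (hdense q (by simpa using hq)) ε₀
          (by positivity)
        obtain ⟨n, hn⟩ := Set.mem_iUnion.1 ha
        exact Set.mem_iUnion.2 ⟨n, Set.mem_biUnion hn (by simpa using hd)⟩)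
      (directed_of_isDirected_le fun m n h => Set.biUnion_subset_biUnion_left (hmono h))
    refine ⟨L, fun q hq => ?_⟩
    obtain ⟨a, ha, hd⟩ := Set.mem_iUnion₂.1 (hL (by simpa using hq : q ∈ Metric.sphere 0 1))
    refine ⟨a, ha, ?_⟩
    rw [← dist_eq_norm, dist_comm]
    exact (Metric.mem_ball.1 hd).le
  have step : ∀ (ε : ℝ) (L : ℕ), 0 ≤ ε → ε ≤ ε₀ →
      (∀ q : ℍ[ℝ], ‖q‖ = 1 → ∃ a ∈ Γ L, ‖a - q‖ ≤ ε) →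
      ∀ q : ℍ[ℝ], ‖q‖ = 1 → ∃ a ∈ Γ (17 * L), ‖a - q‖ ≤ ε / 17 := by
    intro ε L hε hle h q hq
    obtain ⟨u, hu, hue⟩ := h q hq
    have hu1 := hnorm _ _ hu
    have hw : ‖q * star u‖ = 1 := by simp [hq, hu1]
    have hwe : ‖q * star u - 1‖ ≤ ε := by
      have : q * star u - 1 = (q - u) * star u := by rw [sub_mul, quaternion_mul_star hu1]
      rw [this, norm_mul, Quaternion.norm_star, hu1, mul_one, norm_sub_rev]
      exact hue
    obtain ⟨a, b, ha, hb, ha1, hb1, hab⟩ := exists_commutator hw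
    obtain ⟨a₀, ha₀, hae⟩ := h a ha
    obtain ⟨b₀, hb₀, hbe⟩ := h b hb
    have hr : √ε ≤ 1 / 170 := by
      rw [Real.sqrt_le_left (by norm_num)]; simpa [hε₀] using hle
    have hr2 : √ε ^ 2 = ε := Real.sq_sqrt hε
    have hr0 : 0 ≤ √ε := Real.sqrt_nonneg ε
    have hcom := norm_commutator_sub_le ha hb (hnorm _ _ ha₀) (hnorm _ _ hb₀)
      (Real.le_sqrt_of_sq_le (ha1.trans hwe)) (Real.le_sqrt_of_sq_le (hb1.trans hwe)) hae hbe
    -- The length grows by the factor 1 + 1 + 7 + 7 + 1 = 17, inverses being seven times as long.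
    -- The error shrinks by the same factor, whence length O(1/δ).
    refine ⟨a₀ * b₀ * (star a₀ * star b₀) * u, ?_, ?_⟩
    · have := hmul _ _ _ _ (hmul _ _ _ _ (hmul _ _ _ _ ha₀ hb₀)
        (hmul _ _ _ _ (hstar _ _ ha₀) (hstar _ _ hb₀))) hu
      refine hmono ?_ this
      omega
    · have e : a₀ * b₀ * (star a₀ * star b₀) * u - q =
          (a₀ * b₀ * (star a₀ * star b₀) - a * b * (star a * star b)) * u := by
        rw [hab, sub_mul, mul_assoc q, quaternion_star_mul hu1, mul_one]
      rw [e, norm_mul, hu1, mul_one]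
      refine hcom.trans ?_
      rw [hr2]
      have h1 : ε ≤ √ε / 170 := by nlinarith
      have h2 : ε * √ε ≤ ε / 170 := by nlinarith
      have h3 : ε * ε ≤ ε * √ε := by nlinarith
      nlinarith
  have iter : ∀ k : ℕ, ∀ q : ℍ[ℝ], ‖q‖ = 1 → ∃ a ∈ Γ (17 ^ k * L), ‖a - q‖ ≤ ε₀ / 17 ^ k := by
    intro k
    induction k with
    | zero => simpa using hL
    | succ k ih =>
      have := step (ε₀ / 17 ^ k) (17 ^ k * L) (by positivity)
        (div_le_self (by positivity) (one_le_pow₀ (by norm_num))) ih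
      intro q hq
      obtain ⟨a, ha, h⟩ := this q hq
      refine ⟨a, ?_, ?_⟩
      · rwa [pow_succ', mul_assoc]
      · rwa [pow_succ, ← div_div]
  refine ⟨17 * (L + 1), by positivity, fun δ hδ hδ1 q hq => ?_⟩
  obtain ⟨k, hk1, hk2⟩ := exists_nat_pow_near (one_le_one_div hδ hδ1) (by norm_num : (1 : ℝ) < 17)
  obtain ⟨a, ha, h⟩ := iter (k + 1) q hq
  refine ⟨_, ?_, a, ha, h.trans ?_⟩
  · push_cast
    rw [pow_succ]
    calc (17 : ℝ) ^ k * 17 * L ≤ 1 / δ * 17 * (L + 1) := by gcongr; linarith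
      _ = _ := by ring
  · rw [div_le_iff₀ (by positivity)]
    rw [div_lt_iff₀ hδ] at hk2
    have : ε₀ ≤ 1 := by rw [hε₀]; norm_num
    nlinarith

end Quaternion

/-! ### Density of the group generated by two rotations -/

section Density

/-- The unit imaginary quaternions. -/
def IsAxis (u : ℍ[ℝ]) : Prop := u.re = 0 ∧ ‖u‖ = 1

theorem IsAxis.star_eq {u : ℍ[ℝ]} (h : IsAxis u) : star u = -u := by
  ext <;> simp [h.1]

theorem IsAxis.mul_self {u : ℍ[ℝ]} (h : IsAxis u) : u * u = -1 := by
  have := quaternion_mul_star h.2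
  rw [h.star_eq, mul_neg] at this
  rw [← this, neg_neg]

theorem IsAxis.sum_sq {u : ℍ[ℝ]} (h : IsAxis u) : u.imI ^ 2 + u.imJ ^ 2 + u.imK ^ 2 = 1 := by
  have := quaternion_norm_sq u
  rw [h.1, h.2] at this
  linarith

/-- The one-parameter group of unit quaternions generated by `u`. -/
noncomputable def rot (u : ℍ[ℝ]) (θ : ℝ) : ℍ[ℝ] := Real.cos θ • 1 + Real.sin θ • u

theorem rot_zero (u : ℍ[ℝ]) : rot u 0 = 1 := by simp [rot]

theorem rot_add {u : ℍ[ℝ]} (h : IsAxis u) (θ φ : ℝ) : rot u (θ + φ) = rot u θ * rot u φ := by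
  have := h.mul_self
  simp only [rot, Real.cos_add, Real.sin_add, mul_add, add_mul, smul_mul_smul_comm, this, one_mul,
    mul_one]
  module

theorem star_rot {u : ℍ[ℝ]} (h : IsAxis u) (θ : ℝ) : star (rot u θ) = rot u (-θ) := by
  simp [rot, h.star_eq]

theorem norm_rot {u : ℍ[ℝ]} (h : IsAxis u) (θ : ℝ) : ‖rot u θ‖ = 1 := by
  apply quaternion_norm_eq_one
  have := h.sum_sq
  simp [rot, h.1]
  linear_combination Real.sin θ ^ 2 * this + Real.cos_sq_add_sin_sq θ

theorem conj_rot {k : ℍ[ℝ]} (hk : ‖k‖ = 1) (u : ℍ[ℝ]) (θ : ℝ) :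
    k * rot u θ * star k = rot (k * u * star k) θ := by
  simp [rot, mul_add, add_mul, quaternion_mul_star hk]

theorem IsAxis.conj {u k : ℍ[ℝ]} (hu : IsAxis u) (hk : ‖k‖ = 1) : IsAxis (k * u * star k) := by
  refine ⟨?_, by simp [hu.2, hk]⟩
  simp [hu.1]
  ring

theorem exists_eq_cos_sin {x y : ℝ} (h : x ^ 2 + y ^ 2 = 1) :
    ∃ θ : ℝ, Real.cos θ = x ∧ Real.sin θ = y := by
  have : ‖(⟨x, y⟩ : ℂ)‖ = 1 := by
    rw [Complex.norm_def, Complex.normSq_mk, ← sq, ← sq, h, Real.sqrt_one]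
  obtain ⟨θ, hθ⟩ := (Complex.norm_eq_one_iff _).1 this
  refine ⟨θ, ?_, ?_⟩
  · rw [← Complex.exp_ofReal_mul_I_re, hθ]
  · rw [← Complex.exp_ofReal_mul_I_im, hθ]

/-- Commuting with `u` forces the imaginary part of `a` to be parallel to `u`; the coefficient is
the inner product `t`. -/
theorem exists_eq_rot {a u : ℍ[ℝ]} (ha : ‖a‖ = 1) (hu : IsAxis u) (h : a * u = u * a) :
    ∃ θ, a = rot u θ := by
  have hs := hu.sum_sq
  have hu0 := hu.1
  set t : ℝ := a.imI * u.imI + a.imJ * u.imJ + a.imK * u.imK with ht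
  simp only [Quaternion.ext_iff] at h
  simp [hu0] at h
  obtain ⟨-, h1, h2, h3⟩ := h
  have e1 : a.imI = t * u.imI := by
    rw [ht]; linear_combination -a.imI * hs + u.imJ * h3 / 2 - u.imK * h2 / 2
  have e2 : a.imJ = t * u.imJ := by
    rw [ht]; linear_combination -a.imJ * hs + u.imK * h1 / 2 - u.imI * h3 / 2
  have e3 : a.imK = t * u.imK := by
    rw [ht]; linear_combination -a.imK * hs + u.imI * h2 / 2 - u.imJ * h1 / 2
  have hn := quaternion_norm_sq a
  rw [ha, e1, e2, e3] at hn
  obtain ⟨θ, hc, hsn⟩ := exists_eq_cos_sin (x := a.re) (y := t)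
    (by linear_combination -hn - t ^ 2 * hs)
  refine ⟨θ, ?_⟩
  ext <;> simp [rot, hc, hsn, hu0, e1, e2, e3]

/-- If the angle θ were a rational multiple of 2π, z = e^{iθ} would be a root of unity, so z and z⁻¹
would be algebraic integers. But (z + z⁻¹ - 1)² = (√2/2)² = 1/2 is not one. -/
theorem irrational_arccos_div : Irrational (Real.arccos ((1 + √2 / 2) / 2) / (2 * Real.pi)) := by
  rintro ⟨r, hr⟩
  set θ := Real.arccos ((1 + √2 / 2) / 2) with hθ
  have hs2 : √2 ^ 2 = 2 := Real.sq_sqrt (by norm_num)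
  have hcos : Real.cos θ = (1 + √2 / 2) / 2 := by
    apply Real.cos_arccos <;> nlinarith [Real.sqrt_nonneg 2]
  have hθr : θ = r * (2 * Real.pi) := by
    rw [hr]; field_simp
  set z : ℂ := Complex.exp (θ * Complex.I) with hz
  have hroot : z ^ r.den = 1 := by
    rw [hz, ← Complex.exp_nat_mul, Complex.exp_eq_one_iff]
    refine ⟨r.num, ?_⟩
    have h1 : (r.den : ℂ) * (r : ℂ) = r.num := by exact_mod_cast Rat.den_mul_eq_num r
    rw [hθr]
    push_cast
    linear_combination (2 * Real.pi * Complex.I) * h1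
  have hint : IsIntegral ℤ z := IsIntegral.of_pow r.pos (by rw [hroot]; exact isIntegral_one)
  have hint' : IsIntegral ℤ z⁻¹ :=
    IsIntegral.of_pow r.pos (by rw [inv_pow, hroot, inv_one]; exact isIntegral_one)
  have hsum : z + z⁻¹ = 1 + √2 / 2 := by
    rw [hz, ← Complex.exp_neg, ← neg_mul, ← Complex.two_cos, ← Complex.ofReal_cos, hcos]
    push_cast; ring
  have hint2 : IsIntegral ℤ (1 / 2 : ℂ) := by
    have h : IsIntegral ℤ (((z + z⁻¹) - 1) ^ 2) := ((hint.add hint').sub isIntegral_one).pow 2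
    convert h using 1
    rw [hsum]
    have := ofReal_sqrt_two_sq
    linear_combination -this / 4
  have hint3 : IsIntegral ℤ (1 / 2 : ℚ) := by
    have : (1 / 2 : ℂ) = algebraMap ℚ ℂ (1 / 2) := by simp
    rw [this] at hint2
    exact (isIntegral_algebraMap_iff (algebraMap ℚ ℂ).injective).1 hint2
  obtain ⟨n, hn⟩ := IsIntegrallyClosed.isIntegral_iff.1 hint3
  simp at hn
  have : (2 * n : ℚ) = 1 := by rw [hn]; norm_num
  norm_cast at this
  omega

variable {K : Set ℍ[ℝ]}

/-- The real part makes `m` a rotation by an angle incommensurable with 2π, so its integer powers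
are dense in the circle of rotations about its axis; `K` is closed and contains the whole circle. -/
theorem rot_mem_of_re_eq (hK : IsClosed K) (hmul : ∀ a ∈ K, ∀ b ∈ K, a * b ∈ K)
    (hstar : ∀ a ∈ K, star a ∈ K) {m : ℍ[ℝ]} (hm : m ∈ K) (hm1 : ‖m‖ = 1)
    (hre : m.re = (1 + √2 / 2) / 2) :
    IsAxis ((√(1 - m.re ^ 2))⁻¹ • m.im) ∧ ∀ φ, rot ((√(1 - m.re ^ 2))⁻¹ • m.im) φ ∈ K := by
  have hs2 : √2 ^ 2 = 2 := Real.sq_sqrt (by norm_num)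
  have hs0 := Real.sqrt_nonneg 2
  have hlt : m.re ^ 2 < 1 := by rw [hre]; nlinarith
  set s := √(1 - m.re ^ 2) with hs
  have hspos : 0 < s := Real.sqrt_pos.2 (by linarith)
  have hssq : s ^ 2 = 1 - m.re ^ 2 := Real.sq_sqrt (by linarith)
  have hu : IsAxis (s⁻¹ • m.im) := by
    refine ⟨by simp, quaternion_norm_eq_one ?_⟩
    have := quaternion_norm_sq m
    simp
    field_simp
    rw [hssq]
    rw [hm1] at this
    linarith
  refine ⟨hu, ?_⟩
  set u := s⁻¹ • m.im
  set θ := Real.arccos ((1 + √2 / 2) / 2) with hθ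
  have hmθ : m = rot u θ := by
    have h1 : Real.cos θ = m.re := by
      rw [hre]; apply Real.cos_arccos <;> nlinarith
    have h2 : Real.sin θ = s := by rw [hs, hre]; exact Real.sin_arccos _
    rw [rot, h1, h2, smul_smul, mul_inv_cancel₀ hspos.ne', one_smul]
    ext <;> simp
  have hnat : ∀ n : ℕ, rot u (n * θ) ∈ K := by
    intro n
    induction n with
    | zero =>
      have := hmul _ hm _ (hstar _ hm)
      rw [quaternion_mul_star hm1] at this
      simpa [rot_zero] using this
    | succ n ih =>
      rw [Nat.cast_succ, add_mul, one_mul, rot_add hu, ← hmθ]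
      exact hmul _ ih _ hm
  have hint : ∀ n : ℤ, rot u (n * θ) ∈ K := by
    intro n
    obtain ⟨k, rfl | rfl⟩ := n.eq_nat_or_neg
    · exact_mod_cast hnat k
    · have := hstar _ (hnat k)
      rw [star_rot hu] at this
      simpa using this
  let f : Real.Angle → ℍ[ℝ] := fun a => a.cos • 1 + a.sin • u
  have hf : Continuous f :=
    (Real.Angle.continuous_cos.smul continuous_const).add
      (Real.Angle.continuous_sin.smul continuous_const)
  have hfrot : ∀ x : ℝ, f x = rot u x := fun x => by simp [f, rot]
  have hd : DenseRange (fun n : ℤ => n • (θ : AddCircle (2 * Real.pi))) :=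
    AddCircle.denseRange_zsmul_coe_iff.2 irrational_arccos_div
  have hall : ∀ a : Real.Angle, a ∈ f ⁻¹' K := by
    intro a
    refine isClosed_property (p := fun a => f a ∈ K) hd (hK.preimage hf) (fun n => ?_) a
    have : n • (θ : AddCircle (2 * Real.pi)) = ((n * θ : ℝ) : AddCircle (2 * Real.pi)) := by
      rw [← AddCircle.coe_zsmul, zsmul_eq_mul]
    rw [this]
    exact (hfrot (n * θ)).symm ▸ hint n
  intro φ
  rw [← hfrot]
  exact hall φ

/-- Turning `u` about `v` through the quaternionic angle b gives an axis whose inner product with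
`u` is 1 - (2 - 2d²) sin² b. It can be made zero exactly when 1/(2 - 2d²) ≤ 1, that is d² ≤ 1/2. -/
theorem exists_orthogonal_axis (hmul : ∀ a ∈ K, ∀ b ∈ K, a * b ∈ K)
    (hstar : ∀ a ∈ K, star a ∈ K) {u v : ℍ[ℝ]} (hu : IsAxis u) (hv : IsAxis v)
    (hd : (u.imI * v.imI + u.imJ * v.imJ + u.imK * v.imK) ^ 2 ≤ 1 / 2)
    (huK : ∀ φ, rot u φ ∈ K) (hvK : ∀ φ, rot v φ ∈ K) :
    ∃ w, IsAxis w ∧ w * u = -(u * w) ∧ ∀ φ, rot w φ ∈ K := by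
  set d := u.imI * v.imI + u.imJ * v.imJ + u.imK * v.imK with hdd
  have hpos : 0 < 2 - 2 * d ^ 2 := by linarith
  obtain ⟨b, hc, hs⟩ := exists_eq_cos_sin (x := √(1 - 1 / (2 - 2 * d ^ 2)))
    (y := √(1 / (2 - 2 * d ^ 2))) (by
      rw [Real.sq_sqrt, Real.sq_sqrt (by positivity)]
      · ring
      · rw [sub_nonneg, div_le_one hpos]; linarith)
  have hs2 : Real.sin b ^ 2 * (2 - 2 * d ^ 2) = 1 := by
    rw [hs, Real.sq_sqrt (by positivity), one_div_mul_cancel hpos.ne']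
  have hk := norm_rot hv b
  have hw := hu.conj hk
  refine ⟨rot v b * u * star (rot v b), hw, ?_, fun φ => ?_⟩
  · set w := rot v b * u * star (rot v b) with hwdef
    have hdot : w.imI * u.imI + w.imJ * u.imJ + w.imK * u.imK = 0 := by
      have h1 := hu.sum_sq
      have h2 := hv.sum_sq
      have h3 := hu.1
      have h4 := hv.1
      have h5 := Real.cos_sq_add_sin_sq b
      have : w.imI * u.imI + w.imJ * u.imJ + w.imK * u.imK =
          Real.cos b ^ 2 * (u.imI ^ 2 + u.imJ ^ 2 + u.imK ^ 2) + Real.sin b ^ 2 * (2 * d ^ 2 -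
            (u.imI ^ 2 + u.imJ ^ 2 + u.imK ^ 2) * (v.imI ^ 2 + v.imJ ^ 2 + v.imK ^ 2)) := by
        simp [hwdef, rot, h3, h4, hdd]
        ring
      rw [this, h1, h2]
      linear_combination h5 - hs2
    have hw0 := hw.1
    have hu0 := hu.1
    ext <;> simp [hw0, hu0] <;> linarith
  · rw [← conj_rot hk]
    exact hmul _ (hmul _ (hvK _) _ (huK _)) _ (hstar _ (hvK _))

/-- Anticommuting with `u` means being orthogonal to it. Two axes orthogonal to `u` differ by a
rotation about `u`: -(y·w) commutes with `u`, so it is some `rot u θ`, and conjugation by `rot u (θ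
/ 2)` carries `w` to `y`. -/
theorem rot_mem_of_anticommute (hmul : ∀ a ∈ K, ∀ b ∈ K, a * b ∈ K)
    (hstar : ∀ a ∈ K, star a ∈ K) {u w y : ℍ[ℝ]} (hu : IsAxis u) (hw : IsAxis w) (hy : IsAxis y)
    (hwu : w * u = -(u * w)) (hyu : y * u = -(u * y))
    (huK : ∀ φ, rot u φ ∈ K) (hwK : ∀ φ, rot w φ ∈ K) : ∀ φ, rot y φ ∈ K := by
  have hcomm : (-(y * w)) * u = u * (-(y * w)) := by
    rw [neg_mul, mul_assoc, hwu, mul_neg, ← mul_assoc, hyu]; noncomm_ring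
  obtain ⟨θ, hθ⟩ := exists_eq_rot (a := -(y * w)) (by simp [hy.2, hw.2]) hu hcomm
  have hcw : w * rot u (-(θ / 2)) = rot u (θ / 2) * w := by
    simp [rot, mul_add, add_mul, hwu]
  have hyw : y = rot u (θ / 2) * w * star (rot u (θ / 2)) := by
    rw [star_rot hu, mul_assoc, hcw, ← mul_assoc, ← rot_add hu, add_halves, ← hθ, neg_mul,
      mul_assoc, hw.mul_self]
    simp
  intro φ
  rw [hyw, ← conj_rot (norm_rot hu _)]
  exact hmul _ (hmul _ (huK _) _ (hwK _)) _ (hstar _ (huK _))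

/-- Every unit quaternion is a rotation about some axis x. If x is parallel to `u`, it is reached
from `u` by pivoting about `w`. Otherwise the commutator of `u` and x points along their cross
product: pivoting about `u` reaches that axis, and pivoting about that axis then takes `u` to x. -/
theorem mem_of_orthogonal_axes (hmul : ∀ a ∈ K, ∀ b ∈ K, a * b ∈ K)
    (hstar : ∀ a ∈ K, star a ∈ K) {u w : ℍ[ℝ]} (hu : IsAxis u) (hw : IsAxis w)
    (hwu : w * u = -(u * w)) (huK : ∀ φ, rot u φ ∈ K) (hwK : ∀ φ, rot w φ ∈ K)
    {q : ℍ[ℝ]} (hq : ‖q‖ = 1) : q ∈ K := by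
  have normalize : ∀ y : ℍ[ℝ], y.re = 0 → y ≠ 0 → IsAxis (‖y‖⁻¹ • y) := by
    intro y hy hy0
    refine ⟨by simp [hy], ?_⟩
    rw [norm_smul, norm_inv, norm_norm, inv_mul_cancel₀ (norm_ne_zero_iff.2 hy0)]
  have axis : ∀ x : ℍ[ℝ], IsAxis x → ∀ φ, rot x φ ∈ K := by
    intro x hx
    by_cases h : x * u = u * x
    · obtain ⟨θ, hθ⟩ := exists_eq_rot hx.2 hu h
      have hre := hx.1
      rw [hθ] at hre
      simp [rot, hu.1] at hre
      have hxs : x = Real.sin θ • u := by rw [hθ, rot, hre]; simp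
      refine rot_mem_of_anticommute hmul hstar hw hu hx ?_ ?_ hwK huK
      · rw [hwu, neg_neg]
      · rw [hxs]; simp [hwu]
    · set y := u * x - x * u with hydef
      have hy0 : y ≠ 0 := fun h0 => h (sub_eq_zero.1 h0).symm
      have hyre : y.re = 0 := by simp [hydef, hu.1, hx.1]; ring
      have hy := normalize y hyre hy0
      have e1 : y * u = -(u * y) := by
        have := hu.mul_self
        have h2 : u * (u * x) = -x := by rw [← mul_assoc, this]; simp
        rw [hydef, sub_mul, mul_sub, mul_assoc x, this, h2, mul_assoc]
        simp
      have e2 : y * x = -(x * y) := by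
        have := hx.mul_self
        have h2 : x * (x * u) = -u := by rw [← mul_assoc, this]; simp
        rw [hydef, sub_mul, mul_sub, mul_assoc u, this, h2, mul_assoc]
        simp
        abel
      have hyK : ∀ φ, rot (‖y‖⁻¹ • y) φ ∈ K :=
        rot_mem_of_anticommute hmul hstar hu hw hy hwu (by simp [e1]) huK hwK
      exact rot_mem_of_anticommute hmul hstar hy hu hx (by simp [e1]) (by simp [e2]) hyK huK
  by_cases h : q.im = 0
  · obtain ⟨θ, hθ⟩ := exists_eq_rot hq hu (by
      have := Quaternion.re_add_im q
      rw [h, add_zero] at this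
      rw [← this]
      exact Quaternion.coe_commutes _ _)
    rw [hθ]; exact huK θ
  · have hx := normalize q.im (by simp) h
    obtain ⟨θ, hθ⟩ := exists_eq_rot hq hx (by
      have := Quaternion.re_add_im q
      have h2 : q * q.im = q.im * q := by
        conv_lhs => rw [← this]
        conv_rhs => rw [← this]
        rw [add_mul, mul_add, Quaternion.coe_commutes]
        simp
      rw [mul_smul_comm, smul_mul_assoc, h2])
    rw [hθ]; exact axis _ hx θ

/-- Two specific rotations generate a dense subgroup of the unit quaternions. -/
theorem mem_of_generators (hK : IsClosed K) (hmul : ∀ a ∈ K, ∀ b ∈ K, a * b ∈ K)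
    (hstar : ∀ a ∈ K, star a ∈ K) (h₁ : quat ((1 + √2 / 2) / 2) (-(√2 / 4))
      (-((1 - √2 / 2) / 2)) (√2 / 4) ∈ K)
    (h₂ : quat ((1 + √2 / 2) / 2) ((1 - √2 / 2) / 2) (-(√2 / 4)) (√2 / 4) ∈ K)
    {q : ℍ[ℝ]} (hq : ‖q‖ = 1) : q ∈ K := by
  have hs2 : √2 ^ 2 = 2 := Real.sq_sqrt (by norm_num)
  have hs0 := Real.sqrt_nonneg 2
  have hs3 : √2 < 3 / 2 := by nlinarith
  obtain ⟨hu, huK⟩ := rot_mem_of_re_eq hK hmul hstar h₁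
    (quaternion_norm_eq_one (by simp; linear_combination hs2 / 4)) rfl
  obtain ⟨hv, hvK⟩ := rot_mem_of_re_eq hK hmul hstar h₂
    (quaternion_norm_eq_one (by simp; linear_combination hs2 / 4)) rfl
  obtain ⟨w, hw, hwu, hwK⟩ := exists_orthogonal_axis hmul hstar hu hv (by
    simp only [quat_re]
    set s := √(1 - ((1 + √2 / 2) / 2) ^ 2) with hs
    have hsq : s ^ 2 = 1 - ((1 + √2 / 2) / 2) ^ 2 := Real.sq_sqrt (by nlinarith)
    have hlow : 1 / 4 ≤ s ^ 2 := by rw [hsq]; nlinarith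
    have : (s⁻¹ ^ 2) * s ^ 2 = 1 := by
      rw [← mul_pow, inv_mul_cancel₀, one_pow]
      rintro h0
      rw [h0] at hlow
      norm_num at hlow
    have hup : s⁻¹ ^ 2 ≤ 4 := by nlinarith [sq_nonneg s⁻¹]
    simp
    have e : s⁻¹ * (√2 / 4) * (s⁻¹ * ((1 - √2 / 2) / 2)) =
        s⁻¹ * ((1 - √2 / 2) / 2) * (s⁻¹ * (√2 / 4)) := by
      ring
    have e2 : s⁻¹ * (√2 / 4) * (s⁻¹ * (√2 / 4)) = s⁻¹ ^ 2 / 8 := by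
      linear_combination (s⁻¹ ^ 2 / 16) * hs2
    -- Two of the three terms of the inner product of the axes cancel, leaving s⁻²/8 ≤ 1/2.
    have e3 : -(s⁻¹ * (√2 / 4) * (s⁻¹ * ((1 - √2 / 2) / 2))) +
      s⁻¹ * ((1 - √2 / 2) / 2) * (s⁻¹ * (√2 / 4)) + s⁻¹ * (√2 / 4) * (s⁻¹ * (√2 / 4)) =
        s⁻¹ ^ 2 / 8 := by rw [e, e2]; ring
    rw [e3]
    nlinarith [sq_nonneg s⁻¹]) huK hvK
  exact mem_of_orthogonal_axes hmul hstar hu hw hwu huK hwK hq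

end Density

/-! ### One-qubit rotations from H and T -/

section OneQubit

/-- The embedding of the quaternions into the `2 × 2` matrices, `i, j, k ↦ -iX, -iY, -iZ`. -/
def toMat (q : ℍ[ℝ]) : Matrix (Fin 2) (Fin 2) ℂ :=
  !![⟨q.re, -q.imK⟩, ⟨-q.imJ, -q.imI⟩; ⟨q.imJ, -q.imI⟩, ⟨q.re, q.imK⟩]

theorem toMat_mul (p q : ℍ[ℝ]) : toMat (p * q) = toMat p * toMat q := by
  ext i j
  fin_cases i <;> fin_cases j <;>
    simp [toMat, Matrix.mul_apply, Fin.sum_univ_two, Complex.ext_iff] <;> constructor <;> ring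

theorem toMat_star (q : ℍ[ℝ]) : toMat (star q) = (toMat q).conjTranspose := by
  ext i j
  fin_cases i <;> fin_cases j <;> simp [toMat, Matrix.conjTranspose_apply, Complex.ext_iff]

theorem toMat_sub (p q : ℍ[ℝ]) : toMat (p - q) = toMat p - toMat q := by
  ext i j
  fin_cases i <;> fin_cases j <;> simp [toMat, Complex.ext_iff]
  all_goals first | ring1 | (constructor <;> ring1)

theorem toMat_coe (r : ℝ) : toMat (r : ℍ[ℝ]) = (r : ℂ) • 1 := by
  ext i j
  fin_cases i <;> fin_cases j <;> simp [toMat, Complex.ext_iff]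

/-- The matrix of `q` is ‖q‖ times a unitary, so quaternion distances are operator-norm distances.
-/
theorem norm_onQubit_toMat {N : ℕ} (i : Fin N) (q : ℍ[ℝ]) : ‖onQubit i (toMat q)‖ = ‖q‖ := by
  have h : (onQubit i (toMat q)).conjTranspose * onQubit i (toMat q) =
      ((‖q‖ * ‖q‖ : ℝ) : ℂ) • 1 := by
    rw [onQubit_conjTranspose, onQubit_mul, ← toMat_star, ← toMat_mul, Quaternion.star_mul_self,
      Quaternion.normSq_eq_norm_mul_self, toMat_coe, onQubit_smul, onQubit_one]
  have h2 := CStarRing.norm_star_mul_self (x := onQubit i (toMat q))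
  rw [Matrix.star_eq_conjTranspose, h, norm_smul, norm_one, mul_one, Complex.norm_real,
    Real.norm_of_nonneg (by positivity)] at h2
  exact ((mul_self_inj (norm_nonneg _) (norm_nonneg _)).1 h2).symm

/-- The unit quaternions that circuits of size at most `n` implement exactly on any one qubit. -/
def reach (n : ℕ) : Set ℍ[ℝ] :=
  {q | ‖q‖ = 1 ∧ ∀ (N : ℕ) (i : Fin N), ∃ G : List (Gate N), G.length ≤ n ∧
    circuitOp G = onQubit i (toMat q)}

theorem reach_mono : Monotone reach := by
  rintro m n h q ⟨hq, hG⟩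
  refine ⟨hq, fun N i => ?_⟩
  obtain ⟨G, h1, h2⟩ := hG N i
  exact ⟨G, h1.trans h, h2⟩

theorem reach_mul (m n : ℕ) (a b : ℍ[ℝ]) (ha : a ∈ reach m) (hb : b ∈ reach n) :
    a * b ∈ reach (m + n) := by
  refine ⟨by rw [norm_mul, ha.1, hb.1, one_mul], fun N i => ?_⟩
  obtain ⟨G, h1, h2⟩ := ha.2 N i
  obtain ⟨G', h1', h2'⟩ := hb.2 N i
  refine ⟨G' ++ G, by simp; omega, ?_⟩
  rw [circuitOp_append, h2, h2', onQubit_mul, toMat_mul]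

theorem reach_star (n : ℕ) (a : ℍ[ℝ]) (ha : a ∈ reach n) : star a ∈ reach (7 * n) := by
  refine ⟨by rw [Quaternion.norm_star, ha.1], fun N i => ?_⟩
  obtain ⟨G, h1, h2⟩ := ha.2 N i
  obtain ⟨G', h1', h2'⟩ := exists_inverse_circuit G
  refine ⟨G', by omega, ?_⟩
  rw [h2', h2, onQubit_conjTranspose, toMat_star]

theorem tMatrix_pow (n : ℕ) : tMatrix ^ n =
    !![1, 0; 0, (((√2 / 2 : ℝ) : ℂ) * (1 + Complex.I)) ^ n] := by
  induction n with
  | zero => ext i j; fin_cases i <;> fin_cases j <;> simp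
  | succ n ih =>
    rw [pow_succ, ih, tMatrix, exp_pi_div_four]
    ext i j
    fin_cases i <;> fin_cases j <;> simp [Matrix.mul_apply, Fin.sum_univ_two, pow_succ]

/-- Quaternions whose matrix is a word of the form `T ^ a * H * T ^ 7 * H * T ^ b` are reachable. -/
theorem mem_reach_of_eq {q : ℍ[ℝ]} (hq : ‖q‖ = 1) (a b : ℕ)
    (h : tMatrix ^ a * hadamardMatrix * tMatrix ^ 7 * hadamardMatrix * tMatrix ^ b = toMat q) :
    q ∈ reach (a + b + 9) := by
  refine ⟨hq, fun N i => ⟨List.replicate b (.phaseT i) ++ [.hadamard i] ++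
    List.replicate 7 (.phaseT i) ++ [.hadamard i] ++ List.replicate a (.phaseT i), ?_, ?_⟩⟩
  · simp; omega
  · simp only [circuitOp_append, circuitOp_replicate, circuitOp_singleton, Gate.toOp, onQubit_pow,
      onQubit_mul, ← h, mul_assoc]

/-- The two generators are the words T·H·T⁷·H and T³·H·T⁷·H·T⁶. Their numbers of T gates, 8 and 16,
are multiples of 8 and H occurs twice, so both have determinant 1 and are unit quaternions with no
phase correction. -/
theorem mem_closure_reach {q : ℍ[ℝ]} (hq : ‖q‖ = 1) : q ∈ closure (⋃ n, reach n) := by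
  have h2 : (√2 : ℂ) ^ 2 = 2 := by rw [sq]; exact ofReal_sqrt_two_sq
  have hs2 : √2 ^ 2 = 2 := Real.sq_sqrt (by norm_num)
  have hs3 : √2 ^ 3 = 2 * √2 := by rw [pow_succ, hs2]
  have hs4 : √2 ^ 4 = 4 := by rw [show √2 ^ 4 = (√2 ^ 2) ^ 2 by ring, hs2]; norm_num
  set w : ℂ := ((√2 / 2 : ℝ) : ℂ) * (1 + Complex.I) with hw
  have hw2 : w ^ 2 = Complex.I := by
    rw [hw]; push_cast
    linear_combination (Complex.I / 2 + (1 + Complex.I ^ 2) / 4) * h2 + Complex.I_sq / 2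
  have hI := Complex.I_sq
  have hw7 : w ^ 7 = ((√2 / 2 : ℝ) : ℂ) * (1 - Complex.I) := by
    calc w ^ 7 = (w ^ 2) ^ 3 * w := by ring
      _ = _ := by
        rw [hw2, hw]; push_cast
        linear_combination ((√2 : ℂ) / 2 * (Complex.I ^ 2 + Complex.I - 1)) * hI
  have hw3 : w ^ 3 = ((√2 / 2 : ℝ) : ℂ) * (Complex.I - 1) := by
    calc w ^ 3 = (w ^ 2) * w := by ring
      _ = _ := by
        rw [hw2, hw]; push_cast
        linear_combination ((√2 : ℂ) / 2) * hI
  have hw6 : w ^ 6 = -Complex.I := by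
    calc w ^ 6 = (w ^ 2) ^ 3 := by ring
      _ = _ := by rw [hw2, Complex.I_pow_three]
  refine mem_of_generators isClosed_closure ?_ ?_ ?_ ?_ hq
  · intro a ha b hb
    refine map_mem_closure₂ continuous_mul ha hb fun x hx y hy => ?_
    obtain ⟨m, hm⟩ := Set.mem_iUnion.1 hx
    obtain ⟨n, hn⟩ := Set.mem_iUnion.1 hy
    exact Set.mem_iUnion.2 ⟨_, reach_mul _ _ _ _ hm hn⟩
  · intro a ha
    refine map_mem_closure continuous_star ha fun x hx => ?_
    obtain ⟨m, hm⟩ := Set.mem_iUnion.1 hx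
    exact Set.mem_iUnion.2 ⟨_, reach_star _ _ hm⟩
  · refine subset_closure (Set.mem_iUnion.2 ⟨_, mem_reach_of_eq
      (quaternion_norm_eq_one (by simp; linear_combination hs2 / 4)) 1 0 ?_⟩)
    rw [tMatrix_pow, tMatrix_pow, tMatrix_pow, ← hw, hw7, hadamardMatrix_eq, hw]
    ext i j
    fin_cases i <;> fin_cases j <;>
      simp [Matrix.mul_apply, Fin.sum_univ_two, toMat, Complex.ext_iff] <;> constructor <;>
      ring_nf <;> (try simp only [hs2, hs3, hs4]) <;> ring_nf
  · refine subset_closure (Set.mem_iUnion.2 ⟨_, mem_reach_of_eq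
      (quaternion_norm_eq_one (by simp; linear_combination hs2 / 4)) 3 6 ?_⟩)
    rw [tMatrix_pow, tMatrix_pow, tMatrix_pow, ← hw, hw7, hw3, hw6, hadamardMatrix_eq]
    ext i j
    fin_cases i <;> fin_cases j <;>
      simp [Matrix.mul_apply, Fin.sum_univ_two, toMat, Complex.ext_iff] <;> constructor <;>
      ring_nf <;> (try simp only [hs2, hs3, hs4]) <;> ring_nf

/-- One-qubit rotations are approximated up to error `δ` by circuits of size `O(1/δ)`. -/
theorem exists_approx_onQubit : ∃ C : ℝ, 0 < C ∧ ∀ δ : ℝ, 0 < δ → δ ≤ 1 → ∀ q : ℍ[ℝ], ‖q‖ = 1 →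
    ∀ (N : ℕ) (i : Fin N), Approx δ (C / δ) (onQubit i (toMat q)) := by
  obtain ⟨C, hC, h⟩ := exists_word_length_le reach reach_mono (fun _ _ h => h.1) reach_mul
    reach_star (fun _ => mem_closure_reach)
  refine ⟨C, hC, fun δ hδ hδ1 q hq N i => ?_⟩
  obtain ⟨n, hn, a, ha, hd⟩ := h δ hδ hδ1 q hq
  obtain ⟨G, h1, h2⟩ := ha.2 N i
  refine ⟨G, le_trans (by exact_mod_cast h1) hn, ?_⟩
  rwa [h2, onQubit_sub, ← toMat_sub, norm_onQubit_toMat]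

end OneQubit

/-! ### Rotations about products of σᶻ -/

section ZRotation

/-- The eigenvalue of `σᶻ` at the basis state `a`. -/
def spin (a : Fin 2) : ℝ := if a = 0 then 1 else -1

theorem spin_add (a b : Fin 2) : spin (a + b) = spin a * spin b := by
  fin_cases a <;> fin_cases b <;> simp [spin]

/-- The eigenvalue of `∏_{i ∈ I} σᶻ_i` at the basis state `x`. -/
def parity {N : ℕ} (I : Finset (Fin N)) (x : Basis N) : ℝ := ∏ i ∈ I, spin (x i)

theorem abs_parity {N : ℕ} (I : Finset (Fin N)) (x : Basis N) : |parity I x| = 1 := by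
  rw [parity, Finset.abs_prod]
  refine Finset.prod_eq_one fun i _ => ?_
  unfold spin
  split_ifs <;> simp

/-- The unitary `exp (iθ ∏_{i ∈ I} σᶻ_i)`. -/
noncomputable def zRot {N : ℕ} (I : Finset (Fin N)) (θ : ℝ) : Op N :=
  Matrix.diagonal fun x => Complex.exp ((θ * parity I x : ℝ) * Complex.I)

theorem diagonal_exp_mem_unitary {n : Type*} [Fintype n] [DecidableEq n] (f : n → ℝ) :
    Matrix.diagonal (fun x => Complex.exp (f x * Complex.I)) ∈ unitary (Matrix n n ℂ) := by
  have h : (Matrix.diagonal (fun x => Complex.exp (f x * Complex.I))).conjTranspose *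
      Matrix.diagonal (fun x => Complex.exp (f x * Complex.I)) = 1 := by
    rw [Matrix.diagonal_conjTranspose, Matrix.diagonal_mul_diagonal, ← Matrix.diagonal_one]
    congr 1
    ext x
    rw [Pi.star_apply, Complex.star_def, ← Complex.exp_conj, ← Complex.exp_add]
    simp
  exact ⟨h, mul_eq_one_comm.1 h⟩

theorem zRot_mem_unitary {N : ℕ} (I : Finset (Fin N)) (θ : ℝ) : zRot I θ ∈ unitary (Op N) :=
  diagonal_exp_mem_unitary _

theorem zRot_singleton {N : ℕ} (i : Fin N) (θ : ℝ) :
    zRot {i} θ = onQubit i (toMat (quat (Real.cos θ) 0 0 (-Real.sin θ))) := by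
  ext x y
  simp only [zRot, parity, Finset.prod_singleton, onQubit, Matrix.of_apply, Matrix.diagonal_apply]
  have e : ∀ φ : ℝ, Complex.exp (φ * Complex.I) = ⟨Real.cos φ, Real.sin φ⟩ := by
    intro φ
    apply Complex.ext
    · rw [Complex.exp_ofReal_mul_I_re]
    · rw [Complex.exp_ofReal_mul_I_im]
  rw [e]
  by_cases hxy : x = y
  · subst hxy
    rcases Fin.exists_fin_two.1 ⟨x i, rfl⟩ with h | h <;> simp [h, spin, toMat]
  · rw [if_neg hxy]
    split_ifs with h
    · have hi : x i ≠ y i := fun hi => hxy (funext fun j => by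
        rcases eq_or_ne j i with rfl | hj
        · exact hi
        · exact h j hj)
      rcases Fin.exists_fin_two.1 ⟨x i, rfl⟩ with h1 | h1 <;>
        rcases Fin.exists_fin_two.1 ⟨y i, rfl⟩ with h2 | h2 <;>
        simp [h1, h2, toMat, Complex.ext_iff] at hi ⊢
    · rfl

theorem parity_comp_cnotPerm {N : ℕ} {c t : Fin N} (h : c ≠ t) {I : Finset (Fin N)} (hc : c ∉ I)
    (ht : t ∈ I) (y : Basis N) : parity I (cnotPerm h y) = parity (insert c I) y := by
  rw [parity, parity, Finset.prod_insert hc, ← Finset.mul_prod_erase _ _ ht,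
    ← Finset.mul_prod_erase _ _ ht]
  have h1 : cnotPerm h y t = y t + y c := Function.update_self _ _ _
  have h2 : ∀ j ∈ I.erase t, spin (cnotPerm h y j) = spin (y j) := fun j hj => by
    congr 1
    exact Function.update_of_ne (Finset.ne_of_mem_erase hj) _ _
  rw [Finset.prod_congr rfl h2, h1, spin_add]
  ring

/-- The bound `C` on the cost of one-qubit rotations: errors `δ` need `C / δ` gates. -/
def OneQubitCost (C : ℝ) : Prop :=
  0 < C ∧ ∀ δ : ℝ, 0 < δ → δ ≤ 1 → ∀ q : ℍ[ℝ], ‖q‖ = 1 →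
    ∀ (N : ℕ) (i : Fin N), Approx δ (C / δ) (onQubit i (toMat q))

/-- Each additional site costs one `CNOT` on either side, which folds its spin into the parity. Only
the innermost single-site rotation is approximate, so the accuracy does not deteriorate with the
size of `I`. -/
theorem approx_zRot {C : ℝ} (hC : OneQubitCost C) {N : ℕ} {I : Finset (Fin N)} (hI : I.Nonempty)
    {δ : ℝ} (hδ : 0 < δ) (hδ1 : δ ≤ 1) (θ : ℝ) : Approx δ (C / δ + 2 * I.card) (zRot I θ) := by
  induction hI using Finset.Nonempty.cons_induction with
  | singleton i =>
    rw [zRot_singleton]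
    refine (hC.2 δ hδ hδ1 _ (quaternion_norm_eq_one (by simp)) N i).mono le_rfl (by simp)
  | cons c s hc hs ih =>
    obtain ⟨t, ht⟩ := hs
    have hct : c ≠ t := fun h => hc (h ▸ ht)
    have e : zRot (Finset.cons c s hc) θ =
        (Gate.cnot c t hct).toOp * (zRot s θ * (Gate.cnot c t hct).toOp) := by
      rw [← mul_assoc, zRot, zRot, cnot_mul_diagonal_mul_cnot]
      congr 1
      ext x
      rw [Function.comp, parity_comp_cnotPerm hct hc ht, Finset.cons_eq_insert]
    have hg : Approx 0 1 (Gate.cnot c t hct).toOp := by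
      simpa [circuitOp_singleton] using Approx.of_circuit [Gate.cnot c t hct]
    have hgu : (Gate.cnot c t hct).toOp ∈ unitary (Op N) := by
      simpa [circuitOp_singleton] using circuitOp_mem_unitary [Gate.cnot c t hct]
    rw [e]
    refine (hg.mul (ih.mul hg (norm_le_one_of_mem_unitary hgu))
      (norm_le_one_of_mem_unitary (mul_mem (zRot_mem_unitary _ _) hgu))).mono (by simp) ?_
    rw [Finset.card_cons]; push_cast; linarith

end ZRotation

/-! ### Exponentials of Pauli strings -/

section Pauli

/-- The Pauli matrices `1, X, Y, Z`. -/
def pauli : Fin 4 → Matrix (Fin 2) (Fin 2) ℂ :=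
  ![1, !![0, 1; 1, 0], !![0, -Complex.I; Complex.I, 0], !![1, 0; 0, -1]]

/-- A unitary that conjugates `Z` to the given Pauli matrix. -/
noncomputable def pauliFrame : Fin 4 → Matrix (Fin 2) (Fin 2) ℂ :=
  ![1, hadamardMatrix, tMatrix ^ 2 * hadamardMatrix, 1]

theorem pauli_eq_conj (p : Fin 4) :
    pauli p = pauliFrame p * (if p = 0 then 1 else !![1, 0; 0, -1]) *
      (pauliFrame p).conjTranspose := by
  have h2 : (√2 : ℂ) ^ 2 = 2 := by rw [sq]; exact ofReal_sqrt_two_sq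
  have hI := Complex.I_sq
  have hX : hadamardMatrix * !![1, 0; 0, -1] * hadamardMatrix = !![0, 1; 1, 0] := by
    rw [hadamardMatrix_eq]
    ext i j
    fin_cases i <;> fin_cases j <;> simp [Matrix.mul_apply, Fin.sum_univ_two] <;>
      linear_combination h2 / 2
  fin_cases p
  · simp [pauli, pauliFrame]
  · simp [pauli, pauliFrame, hadamardMatrix_conjTranspose, hX]
  · have hw2 : (((√2 / 2 : ℝ) : ℂ) * (1 + Complex.I)) ^ 2 = Complex.I := by
      push_cast
      linear_combination (Complex.I / 2 + (1 + Complex.I ^ 2) / 4) * h2 + Complex.I_sq / 2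
    have : pauliFrame 2 * !![1, 0; 0, -1] * (pauliFrame 2).conjTranspose =
        tMatrix ^ 2 * (hadamardMatrix * !![1, 0; 0, -1] * hadamardMatrix) *
          (tMatrix ^ 2).conjTranspose := by
      simp [pauliFrame, Matrix.conjTranspose_mul, hadamardMatrix_conjTranspose, mul_assoc]
    simp only [Fin.reduceFinMk, Fin.isValue]
    rw [if_neg (by decide), this, hX, tMatrix_pow, hw2]
    ext i j
    fin_cases i <;> fin_cases j <;>
      simp [pauli, Matrix.mul_apply, Fin.sum_univ_two, Matrix.conjTranspose_apply]
  · simp [pauli, pauliFrame]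

theorem pauliFrame_mul_conjTranspose (p : Fin 4) :
    (pauliFrame p).conjTranspose * pauliFrame p = 1 := by
  have hT : (tMatrix ^ 2).conjTranspose * tMatrix ^ 2 = 1 := by
    rw [Matrix.conjTranspose_pow, sq, sq, mul_assoc, ← mul_assoc _ tMatrix tMatrix,
      tMatrix_conjTranspose_mul_self, one_mul, tMatrix_conjTranspose_mul_self]
  fin_cases p
  · simp [pauliFrame]
  · simp [pauliFrame, hadamardMatrix_conjTranspose, hadamardMatrix_mul_self]
  · show (tMatrix ^ 2 * hadamardMatrix).conjTranspose * (tMatrix ^ 2 * hadamardMatrix) = 1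
    rw [Matrix.conjTranspose_mul, mul_assoc, ← mul_assoc (tMatrix ^ 2).conjTranspose, hT, one_mul,
      hadamardMatrix_conjTranspose, hadamardMatrix_mul_self]
  · simp [pauliFrame]

theorem exists_circuit_pauliFrame {N : ℕ} (i : Fin N) (p : Fin 4) :
    ∃ G : List (Gate N), G.length ≤ 3 ∧ circuitOp G = onQubit i (pauliFrame p) := by
  fin_cases p
  · exact ⟨[], by simp, by simp [circuitOp_nil, pauliFrame, onQubit_one]⟩
  · exact ⟨[.hadamard i], by simp, by simp [circuitOp_singleton, pauliFrame, Gate.toOp]⟩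
  · refine ⟨[.hadamard i] ++ List.replicate 2 (.phaseT i), by simp, ?_⟩
    rw [circuitOp_append, circuitOp_replicate, circuitOp_singleton]
    simp [pauliFrame, Gate.toOp, onQubit_pow, onQubit_mul]
  · exact ⟨[], by simp, by simp [circuitOp_nil, pauliFrame, onQubit_one]⟩

theorem exists_circuit_tens {N ℓ : ℕ} (g : Fin N → Matrix (Fin 2) (Fin 2) ℂ)
    (h : ∀ i, ∃ G : List (Gate N), G.length ≤ ℓ ∧ circuitOp G = onQubit i (g i)) :
    ∃ G : List (Gate N), G.length ≤ ℓ * N ∧ circuitOp G = tens g := by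
  suffices H : ∀ F : Finset (Fin N), ∃ G : List (Gate N), G.length ≤ ℓ * F.card ∧
      circuitOp G = tens (fun i => if i ∈ F then g i else 1) by
    simpa using H Finset.univ
  intro F
  induction F using Finset.induction_on with
  | empty => exact ⟨[], by simp, by simp [circuitOp_nil, tens_one]⟩
  | insert a F ha ih =>
    obtain ⟨G, h1, h2⟩ := ih
    obtain ⟨G', h1', h2'⟩ := h a
    refine ⟨G ++ G', ?_, ?_⟩
    · rw [Finset.card_insert_of_notMem ha, mul_add]
      simp; omega
    · rw [circuitOp_append, h2, h2', onQubit_eq_tens, tens_mul]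
      congr 1
      ext1 i
      rcases eq_or_ne i a with rfl | hi
      · simp [ha]
      · simp [hi]

/-- The Pauli string with letters `p`. -/
def pauliString {ι : Type*} [Fintype ι] (p : ι → Fin 4) : Matrix (ι → Fin 2) (ι → Fin 2) ℂ :=
  tens fun i => pauli (p i)

theorem pauliString_eq_conj {N : ℕ} (p : Fin N → Fin 4) :
    pauliString p = tens (fun i => pauliFrame (p i)) *
      Matrix.diagonal (fun x => ((parity (Finset.univ.filter fun i => p i ≠ 0) x : ℝ) : ℂ)) *
      (tens (fun i => pauliFrame (p i))).conjTranspose := by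
  have hZ : Matrix.diagonal
      (fun x => ((parity (Finset.univ.filter fun i => p i ≠ 0) x : ℝ) : ℂ)) =
      tens (fun i => if p i = 0 then (1 : Matrix (Fin 2) (Fin 2) ℂ) else !![1, 0; 0, -1]) := by
    ext x y
    have : ∀ i, (if p i = 0 then (1 : Matrix (Fin 2) (Fin 2) ℂ) else !![1, 0; 0, -1]) (x i) (y i) =
        if x i = y i then (if p i ≠ 0 then ((spin (x i) : ℝ) : ℂ) else 1) else 0 := by
      intro i
      generalize x i = a
      generalize y i = b
      fin_cases a <;> fin_cases b <;> by_cases hp : p i = 0 <;> simp [hp, spin]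
    simp only [tens, Matrix.of_apply, this, Matrix.diagonal_apply, parity]
    rw [Fintype.prod_ite_zero]
    simp only [funext_iff]
    split_ifs with h
    · rw [Finset.prod_filter, Complex.ofReal_prod]
      refine Finset.prod_congr rfl fun i _ => ?_
      split_ifs <;> simp
    · rfl
  rw [hZ, tens_conjTranspose, tens_mul, tens_mul, pauliString]
  congr 1
  ext1 i
  exact pauli_eq_conj (p i)

theorem pauliFrame_tens_mem_unitary {N : ℕ} (p : Fin N → Fin 4) :
    tens (fun i => pauliFrame (p i)) ∈ unitary (Op N) := by
  have h : (tens (fun i => pauliFrame (p i))).conjTranspose * tens (fun i => pauliFrame (p i)) =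
      (1 : Op N) := by
    rw [tens_conjTranspose, tens_mul]
    simp only [pauliFrame_mul_conjTranspose, tens_one]
  exact ⟨h, mul_eq_one_comm.1 h⟩

theorem exp_unitary_conj {n : Type*} [Fintype n] [DecidableEq n] {U : Matrix n n ℂ}
    (hU : U ∈ unitary (Matrix n n ℂ)) (A : Matrix n n ℂ) :
    NormedSpace.exp (U * A * U.conjTranspose) = U * NormedSpace.exp A * U.conjTranspose := by
  have hinv : U⁻¹ = U.conjTranspose := Matrix.inv_eq_right_inv hU.2
  rw [← hinv]
  exact Matrix.exp_conj U A (IsUnit.of_mul_eq_one _ hU.2)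

theorem exp_pauliString {N : ℕ} (p : Fin N → Fin 4) (θ : ℝ) :
    NormedSpace.exp (((θ : ℂ) * Complex.I) • pauliString p) =
      tens (fun i => pauliFrame (p i)) * zRot (Finset.univ.filter fun i => p i ≠ 0) θ *
      (tens (fun i => pauliFrame (p i))).conjTranspose := by
  rw [pauliString_eq_conj, ← smul_mul_assoc, ← mul_smul_comm,
    exp_unitary_conj (pauliFrame_tens_mem_unitary p), ← Matrix.diagonal_smul, Matrix.exp_diagonal,
    zRot]
  congr 3
  ext x
  rw [Pi.coe_exp, ← Complex.exp_eq_exp_ℂ]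
  congr 1
  simp
  ring

theorem exp_pauliString_mem_unitary {N : ℕ} (p : Fin N → Fin 4) (θ : ℝ) :
    NormedSpace.exp (((θ : ℂ) * Complex.I) • pauliString p) ∈ unitary (Op N) := by
  rw [exp_pauliString]
  exact mul_mem (mul_mem (pauliFrame_tens_mem_unitary p) (zRot_mem_unitary _ _))
    (Unitary.star_mem (pauliFrame_tens_mem_unitary p))

/-- A local Clifford frame turns the string into a product of σᶻ on its support. The frame costs 3N
gates, its inverse 21N and the `CNOT` ladder at most 2N, which gives 26N. -/
theorem approx_exp_pauliString {C : ℝ} (hC : OneQubitCost C) {N : ℕ} {p : Fin N → Fin 4}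
    (hp : p ≠ 0) {δ : ℝ} (hδ : 0 < δ) (hδ1 : δ ≤ 1) (θ : ℝ) :
    Approx δ (C / δ + 26 * N) (NormedSpace.exp (((θ : ℂ) * Complex.I) • pauliString p)) := by
  rw [exp_pauliString]
  obtain ⟨G, hG, hGe⟩ := exists_circuit_tens (fun i => pauliFrame (p i))
    (fun i => exists_circuit_pauliFrame i (p i))
  have h1 : Approx 0 (3 * N) (tens (fun i => pauliFrame (p i))) := by
    rw [← hGe]
    exact (Approx.of_circuit G).mono le_rfl (by exact_mod_cast hG)
  have hI : (Finset.univ.filter fun i => p i ≠ 0).Nonempty := by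
    obtain ⟨i, hi⟩ := Function.ne_iff.1 hp
    exact ⟨i, by simpa using hi⟩
  have hu := pauliFrame_tens_mem_unitary p
  refine (((h1.mul (approx_zRot hC hI hδ hδ1 θ) (norm_le_one_of_mem_unitary
    (zRot_mem_unitary _ _))).mul h1.conjTranspose (norm_le_one_of_mem_unitary
    (Unitary.star_mem hu)))).mono (by simp) ?_
  have : ((Finset.univ.filter fun i => p i ≠ 0).card : ℝ) ≤ N := by
    exact_mod_cast (Finset.card_le_univ _).trans (by simp)
  linarith

end Pauli

/-! ### The first-order Trotter formula -/

section Trotter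

theorem norm_pow_sub_pow_le {A : Type*} [NormedRing A] [NormOneClass A]
    {a b : A} (ha : ‖a‖ ≤ 1) (hb : ‖b‖ ≤ 1) (m : ℕ) :
    ‖a ^ m - b ^ m‖ ≤ m * ‖a - b‖ := by
  induction m with
  | zero => simp
  | succ m ih =>
    have hbm : ‖b ^ m‖ ≤ 1 := (norm_pow_le _ _).trans (pow_le_one₀ (norm_nonneg _) hb)
    have e : a ^ (m + 1) - b ^ (m + 1) = a * (a ^ m - b ^ m) + (a - b) * b ^ m := by
      rw [pow_succ', pow_succ']; noncomm_ring
    rw [e]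
    calc _ ≤ ‖a‖ * ‖a ^ m - b ^ m‖ + ‖a - b‖ * ‖b ^ m‖ :=
          (norm_add_le _ _).trans (add_le_add (norm_mul_le _ _) (norm_mul_le _ _))
      _ ≤ 1 * (m * ‖a - b‖) + ‖a - b‖ * 1 := by gcongr
      _ = _ := by push_cast; ring

variable {A : Type*} [NormedRing A] [NormedAlgebra ℂ A] [CompleteSpace A] [NormOneClass A]

theorem norm_exp_sub_one_sub_le (x : A) :
    ‖NormedSpace.exp x - 1 - x‖ ≤ Real.exp ‖x‖ - 1 - ‖x‖ := by
  have h1 := NormedSpace.exp_series_hasSum_exp' (𝕂 := ℂ) x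
  have h2 := NormedSpace.exp_series_hasSum_exp' (𝕂 := ℝ) ‖x‖
  rw [← Real.exp_eq_exp_ℝ] at h2
  have h1' := (hasSum_nat_add_iff' 2).2 h1
  have h2' := (hasSum_nat_add_iff' 2).2 h2
  have := h1'.norm_le_of_bounded h2' fun n => by
    rw [norm_smul, norm_inv, Complex.norm_natCast, smul_eq_mul]
    gcongr
    exact norm_pow_le _ _
  simpa [Finset.sum_range_succ, sub_sub] using this

/-- Expanding the product, each word of degree at least two is dominated by the corresponding term
of the scalar exponential; the induction peels off one factor at a time. -/
theorem norm_prod_exp_sub_one_sub_le (l : List A) :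
    ‖(l.map NormedSpace.exp).prod - 1 - l.sum‖ ≤
      Real.exp (l.map norm).sum - 1 - (l.map norm).sum := by
  induction l with
  | nil => simp
  | cons x l ih =>
    simp only [List.map_cons, List.prod_cons, List.sum_cons]
    set P := (l.map NormedSpace.exp).prod
    set σ := (l.map norm).sum
    have hx := norm_exp_sub_one_sub_le x
    have hX : ‖l.sum‖ ≤ σ := by
      simp only [σ]
      clear ih P hx
      induction l with
      | nil => simp
      | cons y l ih => simpa using (norm_add_le _ _).trans (by gcongr)
    have hP1 : ‖P - 1‖ ≤ Real.exp σ - 1 := by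
      calc ‖P - 1‖ = ‖(P - 1 - l.sum) + l.sum‖ := by congr 1; abel
        _ ≤ _ := (norm_add_le _ _).trans (by linarith)
    have hP : ‖P‖ ≤ Real.exp σ := by
      calc ‖P‖ = ‖(P - 1) + 1‖ := by congr 1; abel
        _ ≤ _ := (norm_add_le _ _).trans (by rw [norm_one]; linarith)
    have e : NormedSpace.exp x * P - 1 - (x + l.sum) =
        (NormedSpace.exp x - 1 - x) * P + x * (P - 1) + (P - 1 - l.sum) := by noncomm_ring
    rw [e, Real.exp_add]
    have h0 : 0 ≤ Real.exp ‖x‖ - 1 - ‖x‖ := (norm_nonneg _).trans hx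
    calc _ ≤ ‖NormedSpace.exp x - 1 - x‖ * ‖P‖ + ‖x‖ * ‖P - 1‖ + ‖P - 1 - l.sum‖ :=
          (norm_add₃_le).trans (by gcongr <;> exact norm_mul_le _ _)
      _ ≤ (Real.exp ‖x‖ - 1 - ‖x‖) * Real.exp σ + ‖x‖ * (Real.exp σ - 1) +
          (Real.exp σ - 1 - σ) := by gcongr
      _ = _ := by ring

/-- The first-order Trotter formula. -/
theorem norm_trotter_sub_le (l : List A) {s : ℝ} (hs : (l.map norm).sum ≤ s) {m : ℕ} (hm : 0 < m)
    (hsm : s ≤ m) (h1 : ∀ x ∈ l, ‖NormedSpace.exp (((m : ℂ)⁻¹) • x)‖ ≤ 1)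
    (h2 : ‖NormedSpace.exp (((m : ℂ)⁻¹) • l.sum)‖ ≤ 1) :
    ‖((l.map fun x => NormedSpace.exp (((m : ℂ)⁻¹) • x)).prod) ^ m - NormedSpace.exp l.sum‖ ≤
      2 * s ^ 2 / m := by
  have hm' : (0 : ℝ) < m := by exact_mod_cast hm
  set c : ℂ := (m : ℂ)⁻¹ with hc
  have hcn : ‖c‖ = (m : ℝ)⁻¹ := by rw [hc, norm_inv, Complex.norm_natCast]
  set l' := l.map (fun x => c • x) with hl'
  have hsum : l'.sum = c • l.sum := List.smul_sum.symm
  have hnorm : (l'.map norm).sum = (m : ℝ)⁻¹ * (l.map norm).sum := by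
    rw [hl', List.map_map, ← List.sum_map_mul_left]
    congr 1
    refine List.map_congr_left fun x _ => ?_
    simp [norm_smul, hcn]
  have hprod : (l.map fun x => NormedSpace.exp (c • x)).prod = (l'.map NormedSpace.exp).prod := by
    rw [hl', List.map_map]; rfl
  have hexp : NormedSpace.exp l.sum = NormedSpace.exp (c • l.sum) ^ m := by
    let _ : NormedAlgebra ℚ A := NormedAlgebra.restrictScalars ℚ ℂ A
    rw [← NormedSpace.exp_nsmul, ← Nat.cast_smul_eq_nsmul ℂ, smul_smul, hc,
      mul_inv_cancel₀ (by exact_mod_cast hm.ne'), one_smul]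
  set σ := (l'.map norm).sum with hσ
  have hσ0 : 0 ≤ σ := List.sum_nonneg (by simp)
  have hσs : σ ≤ s / m := by rw [hnorm, div_eq_inv_mul]; gcongr
  have hσ1 : σ ≤ 1 := hσs.trans ((div_le_one hm').2 hsm)
  have hP : ‖(l'.map NormedSpace.exp).prod‖ ≤ 1 := by
    rw [← hprod]
    clear * - h1
    induction l with
    | nil => simp
    | cons x l ih =>
      rw [List.forall_mem_cons] at h1
      rw [List.map_cons, List.prod_cons]
      exact (norm_mul_le _ _).trans (mul_le_one₀ h1.1 (norm_nonneg _) (ih h1.2))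
  have hq : Real.exp σ - 1 - σ ≤ σ ^ 2 :=
    (le_abs_self _).trans (Real.abs_exp_sub_one_sub_id_le (by rwa [abs_of_nonneg hσ0]))
  have hnl : ‖l'.sum‖ ≤ σ := by
    rw [hσ]
    clear * -
    induction l' with
    | nil => simp
    | cons y l ih => simpa using (norm_add_le _ _).trans (by gcongr)
  have hd : ‖(l'.map NormedSpace.exp).prod - NormedSpace.exp l'.sum‖ ≤ 2 * σ ^ 2 := by
    have ha := norm_prod_exp_sub_one_sub_le l'
    have hb := norm_exp_sub_one_sub_le l'.sum
    have hmono : Real.exp ‖l'.sum‖ - 1 - ‖l'.sum‖ ≤ σ ^ 2 :=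
      ((le_abs_self _).trans (Real.abs_exp_sub_one_sub_id_le
        (by rw [abs_of_nonneg (norm_nonneg _)]; linarith))).trans (by gcongr)
    calc _ = ‖((l'.map NormedSpace.exp).prod - 1 - l'.sum) -
          (NormedSpace.exp l'.sum - 1 - l'.sum)‖ := by congr 1; abel
      _ ≤ _ := (norm_sub_le _ _).trans (by linarith)
  rw [hprod, hexp, ← hsum]
  -- Each of the m steps errs by at most 2(s/m)², and errors of contractions add up.
  calc _ ≤ m * ‖(l'.map NormedSpace.exp).prod - NormedSpace.exp l'.sum‖ :=
        norm_pow_sub_pow_le hP (by rwa [hsum]) m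
    _ ≤ m * (2 * (s / m) ^ 2) := by
        refine mul_le_mul_of_nonneg_left (hd.trans ?_) hm'.le
        gcongr
    _ = _ := by field_simp

end Trotter

/-! ### Self-adjoint logarithms of unitary matrices -/

section Logarithm

variable {n : Type*} [Fintype n] [DecidableEq n]

theorem norm_entry_le (M : Matrix n n ℂ) (x y : n) : ‖M x y‖ ≤ ‖M‖ := by
  have h := Matrix.l2_opNorm_mulVec M (EuclideanSpace.single y 1)
  rw [PiLp.norm_single, norm_one, mul_one] at h
  refine le_trans ?_ ((PiLp.norm_apply_le _ x).trans h)
  simp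

/-- Unitary matrices have self-adjoint logarithms. -/
theorem exists_selfAdjoint_log {U : Matrix n n ℂ} (hU : U ∈ unitary (Matrix n n ℂ)) :
    ∃ M : Matrix n n ℂ, M.IsHermitian ∧ ‖M‖ ≤ Real.pi ∧ NormedSpace.exp (Complex.I • M) = U := by
  -- The spectrum is finite, so the jump of the argument on the negative axis does not obstruct the
  -- functional calculus.
  have hcont : ∀ f : ℂ → ℂ, ContinuousOn f (spectrum ℂ U) := fun f =>
    (Matrix.finite_spectrum U).continuousOn _
  have : IsStarNormal U := ⟨by rw [commute_iff_eq, hU.1, hU.2]⟩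
  refine ⟨cfc (fun z : ℂ => (z.arg : ℂ)) U, IsSelfAdjoint.cfc_arg U,
    norm_cfc_le Real.pi_nonneg fun y hy => by simpa using Complex.abs_arg_le_pi y, ?_⟩
  rw [← CFC.exp_eq_normedSpace_exp (𝕜 := ℂ), ← cfc_const_mul _ _ _ (hcont _),
    ← cfc_comp' (hg := ?_) (hf := hcont _)]
  · conv_rhs => rw [← cfc_id' ℂ U]
    refine cfc_congr fun y hy => ?_
    have hy₁ : ‖y‖ = 1 := spectrum.norm_eq_one_of_unitary hU hy
    have h0 : y ≠ 0 := by rintro rfl; simp at hy₁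
    have : Complex.I * y.arg = Complex.log y :=
      Complex.ext (by simp [Complex.log_re, hy₁]) (by simp [Complex.log_im])
    simp only [this, ← Complex.exp_eq_exp_ℂ, Complex.exp_log h0]
  · exact (NormedSpace.exp_continuous).continuousOn

end Logarithm

/-! ### Expansion in Pauli strings -/

section PauliExpansion

variable {ι : Type*} [Fintype ι] [DecidableEq ι]

theorem pauli_conjTranspose (p : Fin 4) : (pauli p).conjTranspose = pauli p := by
  fin_cases p <;> ext i j <;> fin_cases i <;> fin_cases j <;>
    simp [pauli, Matrix.conjTranspose_apply]

theorem pauli_completeness (a b c d : Fin 2) :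
    ∑ p, pauli p a b * star (pauli p c d) = if a = c ∧ b = d then 2 else 0 := by
  fin_cases a <;> fin_cases b <;> fin_cases c <;> fin_cases d <;>
    simp [Fin.sum_univ_four, pauli] <;> norm_num

theorem norm_pauli_le (p : Fin 4) (a b : Fin 2) : ‖pauli p a b‖ ≤ 1 := by
  fin_cases p <;> fin_cases a <;> fin_cases b <;> simp [pauli]

theorem pauliString_completeness (x y z w : ι → Fin 2) :
    ∑ p : ι → Fin 4, pauliString p x y * star (pauliString p z w) =
      if x = z ∧ y = w then 2 ^ Fintype.card ι else 0 := by
  simp only [pauliString, tens, Matrix.of_apply, star_prod, ← Finset.prod_mul_distrib]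
  have := Finset.prod_univ_sum (fun _ : ι => (Finset.univ : Finset (Fin 4)))
    (fun i p => pauli p (x i) (y i) * star (pauli p (z i) (w i)))
  rw [Fintype.piFinset_univ] at this
  rw [← this]
  simp only [pauli_completeness]
  rw [Fintype.prod_ite_zero]
  simp [funext_iff, forall_and]

/-- Self-adjoint operators are real combinations of Pauli strings. -/
theorem exists_pauli_expansion {M : Matrix (ι → Fin 2) (ι → Fin 2) ℂ} (hM : M.IsHermitian) :
    ∃ a : (ι → Fin 4) → ℝ, (∀ p, |a p| ≤ 2 ^ Fintype.card ι * ‖M‖) ∧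
      M = ∑ p, (a p : ℂ) • pauliString p := by
  set n := Fintype.card ι with hn
  -- These are the normalised Hilbert–Schmidt coefficients. They are real because the matrix and the
  -- strings are Hermitian, and completeness of the strings rebuilds the matrix from them.
  let c : (ι → Fin 4) → ℂ := fun p => (2 ^ n)⁻¹ * ∑ x, ∑ y, star (pauliString p x y) * M x y
  have hreal : ∀ p, ((c p).re : ℂ) = c p := by
    intro p
    refine Complex.conj_eq_iff_re.1 ?_
    have hP : (pauliString p).conjTranspose = pauliString p := by
      simp [pauliString, tens_conjTranspose, pauli_conjTranspose]
    simp only [c, map_mul, map_sum, map_inv₀, map_pow, Complex.conj_ofNat]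
    rw [Finset.sum_comm]
    congr 1
    refine Finset.sum_congr rfl fun x _ => Finset.sum_congr rfl fun y _ => ?_
    congr 1
    · have := congrFun (congrFun hP x) y
      rw [Matrix.conjTranspose_apply] at this
      rw [← this]
      rfl
    · exact congrFun (congrFun hM x) y
  refine ⟨fun p => (c p).re, fun p => ?_, ?_⟩
  · refine (Complex.abs_re_le_norm _).trans ?_
    have hb : ∀ x y, ‖star (pauliString p x y) * M x y‖ ≤ ‖M‖ := by
      intro x y
      rw [norm_mul, norm_star]
      have h1 : ‖pauliString p x y‖ ≤ 1 := by
        simp only [pauliString, tens, Matrix.of_apply, norm_prod]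
        exact Finset.prod_le_one (fun _ _ => norm_nonneg _) fun _ _ => norm_pauli_le _ _ _
      calc _ ≤ 1 * ‖M‖ := mul_le_mul h1 (norm_entry_le M x y) (norm_nonneg _) zero_le_one
        _ = _ := one_mul _
    calc ‖c p‖ ≤ (2 ^ n)⁻¹ * ∑ x : ι → Fin 2, ∑ y : ι → Fin 2, ‖M‖ := by
          simp only [c, norm_mul, norm_inv, norm_pow, Complex.norm_ofNat]
          gcongr
          exact (norm_sum_le _ _).trans (Finset.sum_le_sum fun x _ =>
            (norm_sum_le _ _).trans (Finset.sum_le_sum fun y _ => hb x y))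
      _ = _ := by
          simp [← hn]
  · ext x y
    simp only [Matrix.sum_apply, Matrix.smul_apply, smul_eq_mul, hreal]
    symm
    calc ∑ p, c p * pauliString p x y
        = (2 ^ n)⁻¹ * ∑ z, ∑ w, (∑ p : ι → Fin 4, pauliString p x y * star (pauliString p z w)) *
            M z w := by
          simp only [c, Finset.mul_sum, Finset.sum_mul]
          rw [Finset.sum_comm]
          refine Finset.sum_congr rfl fun z _ => ?_
          rw [Finset.sum_comm]
          refine Finset.sum_congr rfl fun w _ => Finset.sum_congr rfl fun p _ => ?_
          ring
      _ = M x y := by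
          simp only [pauliString_completeness]
          rw [Finset.sum_eq_single x, Finset.sum_eq_single y]
          · simp [← hn]
          · intro w _ hw; simp [Ne.symm hw]
          · simp
          · intro z _ hz; simp [Ne.symm hz]
          · simp

end PauliExpansion

/-! ### Circuits for unitaries on few sites -/

section Embedding

variable {N : ℕ} (S : Finset (Fin N))

/-- The operator `B ⊗ 𝟙`, for `B` acting on the spins in `S`. -/
def embed (B : Matrix (S → Fin 2) (S → Fin 2) ℂ) : Op N :=
  Matrix.of fun x y => if ∀ i, i ∉ S → x i = y i then B (fun i => x i) (fun i => y i) else 0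

theorem embed_eq_kronecker (B : Matrix (S → Fin 2) (S → Fin 2) ℂ) :
    embed S B = (Matrix.kroneckerMap (· * ·) B
      (1 : Matrix ({i // i ∉ S} → Fin 2) ({i // i ∉ S} → Fin 2) ℂ)).submatrix
        (Equiv.piEquivPiSubtypeProd (· ∈ S) fun _ => Fin 2)
        (Equiv.piEquivPiSubtypeProd (· ∈ S) fun _ => Fin 2) := by
  ext x y
  simp only [embed, Matrix.of_apply, Matrix.submatrix_apply, Matrix.kroneckerMap_apply,
    Equiv.piEquivPiSubtypeProd_apply, Matrix.one_apply, funext_iff, Subtype.forall]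
  split_ifs <;> simp

theorem embed_mul (B B' : Matrix (S → Fin 2) (S → Fin 2) ℂ) :
    embed S (B * B') = embed S B * embed S B' := by
  simp only [embed_eq_kronecker]
  rw [Matrix.submatrix_mul_equiv, ← Matrix.mul_kronecker_mul, one_mul]

theorem embed_one : embed S 1 = 1 := by
  rw [embed_eq_kronecker, Matrix.kroneckerMap_one_one _ (by simp) (by simp) (by simp)]
  simp

/-- `B ↦ B ⊗ 𝟙` as a homomorphism of algebras. -/
def embedHom : Matrix (S → Fin 2) (S → Fin 2) ℂ →ₐ[ℂ] Op N :=
  AlgHom.ofLinearMap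
    { toFun := embed S
      map_add' := fun B B' => by
        ext x y
        simp only [embed, Matrix.of_apply, Matrix.add_apply]
        split_ifs <;> simp
      map_smul' := fun c B => by
        ext x y
        simp only [embed, Matrix.of_apply, Matrix.smul_apply, RingHom.id_apply]
        split_ifs <;> simp }
    (embed_one S) (embed_mul S)

theorem embedHom_apply (B : Matrix (S → Fin 2) (S → Fin 2) ℂ) : embedHom S B = embed S B := rfl

theorem embed_conjTranspose (B : Matrix (S → Fin 2) (S → Fin 2) ℂ) :
    (embed S B).conjTranspose = embed S B.conjTranspose := by
  ext x y
  simp only [embed, Matrix.of_apply, Matrix.conjTranspose_apply]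
  have : (∀ i, i ∉ S → y i = x i) ↔ ∀ i, i ∉ S → x i = y i := by
    simp only [eq_comm]
  simp only [this]
  split_ifs <;> simp

theorem embed_injective : Function.Injective (embed S) := by
  intro B B' h
  ext a b
  have := congrFun (congrFun h fun i => if hi : i ∈ S then a ⟨i, hi⟩ else 0)
    fun i => if hi : i ∈ S then b ⟨i, hi⟩ else 0
  have hoff : ∀ i, i ∉ S → (if hi : i ∈ S then a ⟨i, hi⟩ else 0) =
      (if hi : i ∈ S then b ⟨i, hi⟩ else 0) := fun i hi => by simp [hi]
  simp only [embed, Matrix.of_apply, if_pos hoff] at this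
  simpa using this

theorem mem_unitary_of_embed {B : Matrix (S → Fin 2) (S → Fin 2) ℂ}
    (h : embed S B ∈ unitary (Op N)) : B ∈ unitary (Matrix (S → Fin 2) (S → Fin 2) ℂ) := by
  have h1 : B.conjTranspose * B = 1 := by
    apply embed_injective S
    rw [embed_mul, embed_one, ← embed_conjTranspose]
    exact h.1
  exact ⟨h1, mul_eq_one_comm.1 h1⟩

/-- The extension of a Pauli string by identities. -/
def extendString (p : S → Fin 4) : Fin N → Fin 4 := fun i => if hi : i ∈ S then p ⟨i, hi⟩ else 0

theorem extendString_ne_zero {p : S → Fin 4} (hp : p ≠ 0) : extendString S p ≠ 0 := by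
  obtain ⟨i, hi⟩ := Function.ne_iff.1 hp
  refine Function.ne_iff.2 ⟨i, ?_⟩
  simpa [extendString] using hi

theorem embed_pauliString (p : S → Fin 4) :
    embed S (pauliString p) = pauliString (extendString S p) := by
  ext x y
  simp only [embed, pauliString, tens, Matrix.of_apply]
  rw [← Fintype.prod_subtype_mul_prod_subtype (· ∈ S)]
  have h2 : ∀ i : {i // i ∉ S}, pauli (extendString S p i) (x i) (y i) =
      if x i = y i then 1 else 0 := by
    rintro ⟨i, hi⟩
    simp [extendString, hi, pauli, Matrix.one_apply]
  have h1 : ∀ i : {i // i ∈ S}, pauli (extendString S p i) (x i) (y i) =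
      pauli (p i) (x i) (y i) := by
    rintro ⟨i, hi⟩
    simp [extendString, hi]
  rw [Finset.prod_congr rfl fun i _ => h1 i, Finset.prod_congr rfl fun i _ => h2 i,
    Fintype.prod_ite_zero]
  simp only [Subtype.forall, Finset.prod_const_one, mul_ite, mul_one, mul_zero]
  split_ifs
  · congr!
  · rfl

theorem pauliString_zero {ι : Type*} [Fintype ι] [DecidableEq ι] :
    pauliString (0 : ι → Fin 4) = 1 := by
  simp [pauliString, pauli, tens_one]

theorem norm_pauliString_le (p : Fin N → Fin 4) : ‖pauliString p‖ ≤ 1 := by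
  have hu := pauliFrame_tens_mem_unitary p
  rw [pauliString_eq_conj]
  refine (norm_mul_le _ _).trans (mul_le_one₀ ((norm_mul_le _ _).trans (mul_le_one₀
    (norm_le_one_of_mem_unitary hu) (norm_nonneg _) ?_)) (norm_nonneg _)
    (norm_le_one_of_mem_unitary (Unitary.star_mem hu)))
  rw [Matrix.l2_opNorm_diagonal]
  refine (pi_norm_le_iff_of_nonneg zero_le_one).2 fun x => ?_
  rw [Complex.norm_real, Real.norm_eq_abs, abs_parity]

theorem pauliString_conjTranspose {ι : Type*} [Fintype ι] (p : ι → Fin 4) :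
    (pauliString p).conjTranspose = pauliString p := by
  simp [pauliString, tens_conjTranspose, pauli_conjTranspose]

/-- Unitaries acting on `S` are, up to a phase, exponentials of sums of Pauli strings. -/
theorem exists_phase_smul_eq_exp {V : Op N} (hV : V ∈ unitary (Op N)) (hS : ActsOn S V) :
    ∃ (c : ℂ) (a : (S → Fin 4) → ℝ), ‖c‖ = 1 ∧ (∀ p, |a p| ≤ 2 ^ S.card * 4) ∧
      c • V = NormedSpace.exp (∑ p ∈ Finset.univ.erase 0,
        ((a p : ℂ) * Complex.I) • pauliString (extendString S p)) := by
  obtain ⟨B, hB⟩ := hS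
  have hVB : V = embed S B := by ext x y; exact hB x y
  subst hVB
  obtain ⟨M, hM, hMπ, hMe⟩ := exists_selfAdjoint_log (mem_unitary_of_embed S hV)
  obtain ⟨a, ha, haM⟩ := exists_pauli_expansion hM
  -- The identity string is central and contributes only a scalar; the phase removes it, since the
  -- circuit bound for exponentials requires a nontrivial string.
  refine ⟨Complex.exp (-(a 0 * Complex.I)), a, ?_, fun p => ?_, ?_⟩
  · rw [← neg_mul, ← Complex.ofReal_neg, Complex.norm_exp_ofReal_mul_I]
  · refine (ha p).trans ?_
    rw [Fintype.card_coe]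
    gcongr
    exact hMπ.trans Real.pi_le_four
  · let _ : NormedAlgebra ℚ (Op N) := NormedAlgebra.restrictScalars ℚ ℂ _
    let _ : NormedAlgebra ℚ (Matrix (S → Fin 2) (S → Fin 2) ℂ) :=
      NormedAlgebra.restrictScalars ℚ ℂ _
    have hcont : Continuous (embedHom S) := (embedHom S).toLinearMap.continuous_of_finiteDimensional
    have h1 : embed S B = NormedSpace.exp (embedHom S (Complex.I • M)) := by
      rw [← hMe, ← embedHom_apply]
      exact NormedSpace.map_exp (embedHom S) hcont _
    have h2 : embedHom S (Complex.I • M) = algebraMap ℂ (Op N) (a 0 * Complex.I) +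
        ∑ p ∈ Finset.univ.erase 0, ((a p : ℂ) * Complex.I) • pauliString (extendString S p) := by
      conv_lhs => rw [haM]
      rw [map_smul, map_sum, ← Finset.add_sum_erase _ _ (Finset.mem_univ 0), smul_add,
        Finset.smul_sum]
      congr 1
      · rw [map_smul, pauliString_zero, map_one, smul_smul,
          Algebra.algebraMap_eq_smul_one, mul_comm]
      · refine Finset.sum_congr rfl fun p _ => ?_
        rw [map_smul, smul_smul, embedHom_apply, embed_pauliString, mul_comm]
    rw [h1, h2, NormedSpace.exp_add_of_commute (Algebra.commutes _ _),
      ← NormedSpace.algebraMap_exp_comm, Algebra.algebraMap_eq_smul_one, smul_mul_assoc, one_mul,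
      smul_smul, ← Complex.exp_eq_exp_ℂ, ← Complex.exp_add]
    simp

/-- The Trotter product of the Pauli expansion has about m·4ⁿ factors, n being the number of sites.
Half of δ pays for the Trotter error and half for compiling the factors. -/
theorem approx_of_actsOn {C : ℝ} (hC : OneQubitCost C) {V : Op N} (hV : V ∈ unitary (Op N))
    (hS : ActsOn S V) {δ : ℝ} (hδ : 0 < δ) (hδ1 : δ ≤ 1) :
    ∃ c : ℂ, ‖c‖ = 1 ∧
      Approx δ (20000 * (C + 1) * (N + 1) * ((4 : ℝ) ^ S.card) ^ 8 / δ ^ 3) (c • V) := by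
  obtain ⟨c, a, hc, ha, hexp⟩ := exists_phase_smul_eq_exp S hV hS
  refine ⟨c, hc, ?_⟩
  have hCpos := hC.1
  set n := S.card with hn
  set X : (S → Fin 4) → Op N := fun p => ((a p : ℂ) * Complex.I) • pauliString (extendString S p)
    with hX
  set l : List (Op N) := (Finset.univ.erase (0 : S → Fin 4)).toList.map X with hl
  have hsum : l.sum = ∑ p ∈ Finset.univ.erase 0, X p := Finset.sum_map_toList _ _
  have hlen : (l.length : ℝ) ≤ 4 ^ n := by
    have : l.length ≤ 4 ^ n := by
      rw [hl, List.length_map, Finset.length_toList]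
      exact (Finset.card_le_univ _).trans (by simp [hn])
    exact_mod_cast this
  have hmem : ∀ x ∈ l, ∃ p : S → Fin 4, p ≠ 0 ∧ x = X p := by
    intro x hx
    rw [hl, List.mem_map] at hx
    obtain ⟨p, hp, rfl⟩ := hx
    exact ⟨p, by simpa using hp, rfl⟩
  set b : ℝ := 4 ^ n with hb
  have hb1 : 1 ≤ b := one_le_pow₀ (by norm_num)
  -- At most 4ⁿ strings, each with coefficient at most 2ⁿ·4, the 4 bounding π.
  set s : ℝ := 4 * 8 ^ n with hs
  have hs1 : 1 ≤ s := by
    have : (1 : ℝ) ≤ 8 ^ n := one_le_pow₀ (by norm_num)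
    linarith
  have hsb : s ^ 2 = 16 * b ^ 3 := by
    rw [hs, hb, mul_pow, ← pow_mul, ← pow_mul, mul_comm n 2, mul_comm n 3, pow_mul, pow_mul]
    norm_num
  have hnorm : (l.map norm).sum ≤ s := by
    have h1 : ∀ y ∈ l.map norm, y ≤ 2 ^ n * 4 := by
      intro y hy
      obtain ⟨x, hx, rfl⟩ := List.mem_map.1 hy
      obtain ⟨p, -, rfl⟩ := hmem x hx
      rw [hX, norm_smul, norm_mul, Complex.norm_I, Complex.norm_real, mul_one, Real.norm_eq_abs]
      calc _ ≤ 2 ^ n * 4 * 1 := mul_le_mul (ha p) (norm_pauliString_le _) (norm_nonneg _)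
            (by positivity)
        _ = _ := mul_one _
    have h2 := List.sum_le_card_nsmul _ _ h1
    rw [List.length_map, nsmul_eq_mul] at h2
    calc _ ≤ _ := h2
      _ ≤ 4 ^ n * (2 ^ n * 4) := by gcongr
      _ = s := by rw [hs, show (8 : ℝ) = 4 * 2 by norm_num, mul_pow]; ring
  -- Makes the Trotter error 2s²/m at most δ/2.
  set m : ℕ := ⌈4 * s ^ 2 / δ⌉₊ with hm
  have hm1 : 4 * s ^ 2 / δ ≤ m := Nat.le_ceil _
  have hs2 : s ^ 2 ≤ s ^ 2 / δ := le_div_self (by positivity) hδ hδ1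
  have hm2 : (m : ℝ) ≤ 5 * s ^ 2 / δ := by
    have := (Nat.ceil_lt_add_one (show 0 ≤ 4 * s ^ 2 / δ by positivity)).le
    calc (m : ℝ) ≤ 4 * s ^ 2 / δ + 1 := this
      _ ≤ 4 * s ^ 2 / δ + s ^ 2 / δ := by nlinarith
      _ = _ := by ring
  have hsm : s ≤ m := by
    refine le_trans ?_ hm1
    rw [mul_div_assoc]
    nlinarith
  have hmpos : (0 : ℝ) < m := by linarith
  have hm0 : 0 < m := by exact_mod_cast hmpos
  have hscale : ∀ p : S → Fin 4, ((m : ℂ)⁻¹) • X p =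
      (((a p / m : ℝ) : ℂ) * Complex.I) • pauliString (extendString S p) := by
    intro p
    rw [hX, smul_smul]
    congr 1
    push_cast
    ring
  have hun : ∀ x ∈ l, NormedSpace.exp (((m : ℂ)⁻¹) • x) ∈ unitary (Op N) := by
    intro x hx
    obtain ⟨p, -, rfl⟩ := hmem x hx
    rw [hscale]
    exact exp_pauliString_mem_unitary _ _
  have hskew : ((m : ℂ)⁻¹) • l.sum ∈ skewAdjoint (Op N) := by
    rw [hsum, Finset.smul_sum]
    refine sum_mem fun p _ => ?_
    rw [hscale, skewAdjoint.mem_iff, star_smul, Matrix.star_eq_conjTranspose,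
      pauliString_conjTranspose, ← neg_smul]
    congr 1
    simp
  let _ : NormedAlgebra ℚ (Op N) := NormedAlgebra.restrictScalars ℚ ℂ _
  have htrot := norm_trotter_sub_le l hnorm hm0 hsm
    (fun x hx => norm_le_one_of_mem_unitary (hun x hx))
    (norm_le_one_of_mem_unitary (NormedSpace.exp_mem_unitary_of_mem_skewAdjoint hskew))
  -- At most m·b exponentials are compiled, so their errors total at most δ/2.
  set δ' : ℝ := δ / (2 * m * b) with hδ'
  have hm1' : (1 : ℝ) ≤ m := hs1.trans hsm
  have hδ'pos : 0 < δ' := by positivity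
  have hδ'1 : δ' ≤ 1 := by
    rw [hδ', div_le_one (by positivity)]
    nlinarith
  have hstep : Approx (l.length * δ') (l.length * (C / δ' + 26 * N))
      (l.map fun x => NormedSpace.exp (((m : ℂ)⁻¹) • x)).prod := by
    have := Approx.list_prod (δ := δ') (L := C / δ' + 26 * N)
      (l.map fun x => NormedSpace.exp (((m : ℂ)⁻¹) • x)) (by
        intro W hW
        obtain ⟨x, hx, rfl⟩ := List.mem_map.1 hW
        obtain ⟨p, hp, rfl⟩ := hmem x hx
        rw [hscale]
        exact approx_exp_pauliString hC (extendString_ne_zero S hp) hδ'pos hδ'1 _) (by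
        intro W hW
        obtain ⟨x, hx, rfl⟩ := List.mem_map.1 hW
        exact hun x hx)
    rwa [List.length_map] at this
  have hprodU : (l.map fun x => NormedSpace.exp (((m : ℂ)⁻¹) • x)).prod ∈ unitary (Op N) := by
    apply Submonoid.list_prod_mem
    intro W hW
    obtain ⟨x, hx, rfl⟩ := List.mem_map.1 hW
    exact hun x hx
  have hpow := Approx.list_prod (List.replicate m
    (l.map fun x => NormedSpace.exp (((m : ℂ)⁻¹) • x)).prod)
    (fun W hW => by rw [List.eq_of_mem_replicate hW]; exact hstep)
    (fun W hW => by rw [List.eq_of_mem_replicate hW]; exact hprodU)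
  rw [List.prod_replicate, List.length_replicate] at hpow
  rw [hexp, ← hsum]
  refine (hpow.of_norm_sub_le htrot).mono ?_ ?_
  · have h1 : m * (l.length * δ') ≤ δ / 2 := by
      calc m * (l.length * δ') ≤ m * (b * δ') := by gcongr
        _ = δ / 2 := by rw [hδ']; field_simp
    have h2 : 2 * s ^ 2 / m ≤ δ / 2 := by
      rw [div_le_iff₀ hδ] at hm1
      rw [div_le_iff₀ hmpos]
      linarith
    linarith
  · set κ : ℝ := 80 * b ^ 4 / δ with hκ
    have hmb : m * b ≤ κ := by
      calc m * b ≤ 5 * s ^ 2 / δ * b := by gcongr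
        _ = κ := by rw [hsb, hκ]; ring
    have hCδ : C / δ' = 2 * (m * b) * C / δ := by
      rw [hδ']; field_simp
    have hκ0 : 0 < κ := by positivity
    calc (m : ℝ) * (l.length * (C / δ' + 26 * N)) ≤ m * (b * (C / δ' + 26 * N)) := by gcongr
      _ = (m * b) * (2 * (m * b) * C / δ + 26 * N) := by rw [hCδ]; ring
      _ ≤ κ * (2 * κ * C / δ + 26 * N) := by gcongr
      _ = (12800 * C * b ^ 8 + 2080 * N * (b ^ 4 * δ ^ 2)) / δ ^ 3 := by
          rw [hκ]; field_simp; ring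
      _ ≤ (12800 * C * b ^ 8 + 2080 * N * (b ^ 8 * 1)) / δ ^ 3 := by
          gcongr
          · norm_num
          · exact pow_le_one₀ hδ.le hδ1
      _ ≤ _ := by
          gcongr
          have h8 : 0 < b ^ 8 := by positivity
          have hN : (0 : ℝ) ≤ N := by positivity
          have : 12800 * C + 2080 * N ≤ 20000 * (C + 1) * (N + 1) := by nlinarith
          calc _ = (12800 * C + 2080 * N) * b ^ 8 := by ring
            _ ≤ _ := by gcongr

end Embedding

/-! ### Circuits for quasilocal unitaries -/

section Quasilocal

/-- The form in which the bound on ξ is used: 1/ξ > 4 log 2 = log 16. The rate 16 has to beat the 2ˢ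
sets of width s and still give an exponent below 1 for t. -/
theorem exp_neg_div_le {ξ : ℝ} (hξ0 : 0 < ξ) (hξ : ξ < 1 / (4 * Real.log 2)) (m : ℕ) :
    Real.exp (-(m : ℝ) / ξ) ≤ (1 / 16) ^ m := by
  have hlog : 0 < Real.log 2 := Real.log_pos (by norm_num)
  have h16 : (1 / 16 : ℝ) ^ m = Real.exp (-(m * (4 * Real.log 2))) := by
    have : (16 : ℝ) = Real.exp (4 * Real.log 2) := by
      rw [mul_comm, Real.exp_mul, Real.exp_log (by norm_num)]
      norm_num
    rw [Real.exp_neg, Real.exp_nat_mul, ← this, one_div, inv_pow]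
  rw [h16, Real.exp_le_exp, neg_div, neg_le_neg_iff, le_div_iff₀ hξ0]
  rw [lt_div_iff₀ (by positivity)] at hξ
  have hm : (0 : ℝ) ≤ m := by positivity
  nlinarith

theorem card_filter_val_le {N : ℕ} (p : Fin N → Prop) [DecidablePred p] (a b : ℕ)
    (h : ∀ i, p i → a ≤ i.val ∧ i.val ≤ b) : (Finset.univ.filter p).card ≤ b + 1 - a := by
  rw [← Nat.card_Icc]
  refine Finset.card_le_card_of_injOn Fin.val (fun i hi => ?_) Fin.val_injective.injOn
  simpa using h i (by simpa using hi)

theorem card_sites_le (N a b n : ℕ) (h : b + 1 ≤ a + n) : (sites N a b).card ≤ n := by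
  have := card_filter_val_le (fun s : Fin N => a ≤ s.val + 1 ∧ s.val + 1 ≤ b) (a - 1) (b - 1)
    (fun i hi => by omega)
  rcases Nat.eq_zero_or_pos b with rfl | hb
  · have : sites N a 0 = ∅ := by simp [sites]
    simp [this]
  · refine this.trans ?_
    omega

theorem IsConstituent.mem_unitary {N n k : ℕ} {ξ q : ℝ} {V : Op N}
    (h : IsConstituent ξ q n k V) : V ∈ unitary (Op N) := by
  obtain ⟨h | ⟨-, A, B, hA, -, hB, -, rfl⟩, -⟩ := h
  · exact h.2.1
  · exact mul_mem hA hB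

theorem IsConstituent.norm_sub_one_le {N n k : ℕ} {ξ q : ℝ} (hξ0 : 0 < ξ)
    (hξ : ξ < 1 / (4 * Real.log 2)) (hn : 1 ≤ n) {V : Op N} (h : IsConstituent ξ q n k V) :
    ‖V - 1‖ ≤ (|q| + 1) / 4 ^ (n - 1) := by
  have h1 := h.2
  rw [norm_sub_rev] at h1
  have e : (n : ℝ) - 1 = ((n - 1 : ℕ) : ℝ) := by push_cast [hn]; ring
  rw [e] at h1
  have h2 := exp_neg_div_le hξ0 hξ (n - 1)
  refine (sq_le_sq₀ (norm_nonneg _) (by positivity)).1 ?_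
  have h3 : (1 / 16 : ℝ) ^ (n - 1) = 1 / (4 ^ (n - 1)) ^ 2 := by
    rw [← pow_mul, mul_comm, pow_mul, one_div, inv_pow, one_div]; norm_num
  calc ‖V - 1‖ ^ 2 ≤ (|q| + 1) ^ 2 * (1 / 16) ^ (n - 1) := by
        refine h1.le.trans (mul_le_mul ?_ h2 (Real.exp_pos _).le (by positivity))
        nlinarith [le_abs_self q, abs_nonneg q]
    _ = _ := by rw [h3, div_pow]; ring

/-- Up to a phase, `W` is approximated by a circuit. -/
def ApproxPhase {N : ℕ} (δ L : ℝ) (W : Op N) : Prop := ∃ c : ℂ, ‖c‖ = 1 ∧ Approx δ L (c • W)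

theorem smul_mem_unitary {N : ℕ} {c : ℂ} (hc : ‖c‖ = 1) {W : Op N} (hW : W ∈ unitary (Op N)) :
    c • W ∈ unitary (Op N) := by
  have hcc : star c * c = 1 := by
    rw [Complex.star_def, Complex.conj_mul', hc]; simp
  have h1 : star (c • W) * (c • W) = 1 := by
    rw [star_smul, smul_mul_smul_comm, hcc, hW.1, one_smul]
  exact ⟨h1, mul_eq_one_comm.1 h1⟩

namespace ApproxPhase
variable {N : ℕ} {δ δ' L L' : ℝ} {W W' : Op N}

theorem mono (h : ApproxPhase δ L W) (hδ : δ ≤ δ') (hL : L ≤ L') : ApproxPhase δ' L' W := by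
  obtain ⟨c, hc, h⟩ := h
  exact ⟨c, hc, h.mono hδ hL⟩

theorem mul (h : ApproxPhase δ L W) (h' : ApproxPhase δ' L' W') (hW' : W' ∈ unitary (Op N)) :
    ApproxPhase (δ + δ') (L + L') (W * W') := by
  obtain ⟨c, hc, h⟩ := h
  obtain ⟨c', hc', h'⟩ := h'
  refine ⟨c * c', by rw [norm_mul, hc, hc', one_mul], ?_⟩
  rw [← smul_mul_smul_comm]
  exact h.mul h' (norm_le_one_of_mem_unitary (smul_mem_unitary hc' hW'))

theorem one : ApproxPhase 0 0 (1 : Op N) := ⟨1, by simp, by simpa using Approx.one⟩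

theorem of_norm_sub_le (h : ApproxPhase δ L W) (hW : ‖W - W'‖ ≤ δ') :
    ApproxPhase (δ + δ') L W' := by
  obtain ⟨c, hc, h⟩ := h
  refine ⟨c, hc, h.of_norm_sub_le ?_⟩
  rwa [← smul_sub, norm_smul, hc, one_mul]

theorem list_prod (l : List (Op N)) (h : ∀ W ∈ l, ApproxPhase δ L W)
    (h1 : ∀ W ∈ l, W ∈ unitary (Op N)) : ApproxPhase (l.length * δ) (l.length * L) l.prod := by
  induction l with
  | nil => simpa using one
  | cons W l ih =>
    rw [List.forall_mem_cons] at h h1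
    refine ((h.1.mul (ih h.2 h1.2) (Submonoid.list_prod_mem _ h1.2))).mono ?_ ?_ <;>
      (push_cast [List.length_cons]; linarith)

end ApproxPhase

theorem IsConstituent.approxPhase {C : ℝ} (hC : OneQubitCost C) {N n k : ℕ} (hk : k ≤ N)
    (hn : 1 ≤ n) {ξ q : ℝ} {V : Op N} (h : IsConstituent ξ q n k V) {δ : ℝ} (hδ : 0 < δ)
    (hδ1 : δ ≤ 1) :
    ApproxPhase δ (320000 * (C + 1) * (N + 1) * ((4 : ℝ) ^ n) ^ 8 / δ ^ 3) V := by
  have hCpos := hC.1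
  have key : ∀ S : Finset (Fin N), S.card ≤ n → ∀ W ∈ unitary (Op N), ActsOn S W →
      ApproxPhase (δ / 2) (160000 * (C + 1) * (N + 1) * ((4 : ℝ) ^ n) ^ 8 / δ ^ 3) W := by
    intro S hS W hW hSW
    obtain ⟨c, hc, h⟩ := approx_of_actsOn S hC hW hSW (half_pos hδ) (by linarith)
    refine ⟨c, hc, h.mono le_rfl ?_⟩
    have : ((4 : ℝ) ^ S.card) ^ 8 ≤ (4 ^ n) ^ 8 := by
      gcongr
      norm_num
    calc _ ≤ 20000 * (C + 1) * (N + 1) * ((4 : ℝ) ^ n) ^ 8 / (δ / 2) ^ 3 := by gcongr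
      _ = _ := by field_simp; ring
  have h0 : 0 ≤ 160000 * (C + 1) * (N + 1) * ((4 : ℝ) ^ n) ^ 8 / δ ^ 3 := by positivity
  have hdouble : 160000 * (C + 1) * (N + 1) * ((4 : ℝ) ^ n) ^ 8 / δ ^ 3 +
      160000 * (C + 1) * (N + 1) * ((4 : ℝ) ^ n) ^ 8 / δ ^ 3 =
      320000 * (C + 1) * (N + 1) * ((4 : ℝ) ^ n) ^ 8 / δ ^ 3 := by ring
  -- When the range wraps around the chain, each of the two pieces still has at most n sites, and
  -- each receives half of the error.
  obtain ⟨⟨-, hV, hS⟩ | ⟨hlt, A, B, hA, hAS, hB, hBS, rfl⟩, -⟩ := h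
  · exact (key _ (card_sites_le _ _ _ _ (by omega)) V hV hS).mono (by linarith) (by linarith)
  · refine ((key _ (card_sites_le _ _ _ _ (by omega)) A hA hAS).mul
      (key _ (card_sites_le _ _ _ _ (by omega)) B hB hBS) hB).mono (by linarith) hdouble.le

/-- The pairs `(n, k)` that index the factors of a quasilocal unitary, in order. -/
def factorIndices (N : ℕ) : List (ℕ × ℕ) :=
  (List.range' 1 N).flatMap fun n =>
    (List.range' 1 n).flatMap fun j =>
      (List.range ((N - n) / n + 1)).map fun i => (n, i * n + j)

theorem factors_eq_map {N : ℕ} (V : ℕ → ℕ → Op N) :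
    factors V = (factorIndices N).map fun p => V p.1 p.2 := by
  simp only [factors, factorIndices, List.map_flatMap, List.map_map, Function.comp_def]

/-- For each n there are n·(⌊(N - n)/n⌋ + 1) ≤ N factors. -/
theorem length_factorIndices_le (N : ℕ) : (factorIndices N).length ≤ N ^ 2 := by
  have h : ∀ n ∈ List.range' 1 N,
      (List.map (fun _ => (N - n) / n + 1) (List.range' 1 n)).sum ≤ N := by
    intro n hn
    simp only [List.mem_range'_1] at hn
    simp only [List.map_const', List.sum_replicate, List.length_range', smul_eq_mul]
    have := Nat.mul_div_le (N - n) n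
    rw [mul_add, mul_one]
    omega
  simp only [factorIndices, List.length_flatMap, List.length_map, List.length_range]
  have h2 := List.sum_le_card_nsmul
    ((List.range' 1 N).map fun n => (List.map (fun _ => (N - n) / n + 1) (List.range' 1 n)).sum) N
    (by
      intro x hx
      obtain ⟨n, hn, rfl⟩ := List.mem_map.1 hx
      exact h n hn)
  simpa [sq] using h2

theorem norm_map_prod_sub_le {N : ℕ} {α : Type*} (l : List α) (f g : α → Op N) {η : ℝ}
    (hf : ∀ a ∈ l, f a ∈ unitary (Op N)) (hg : ∀ a ∈ l, g a ∈ unitary (Op N))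
    (h : ∀ a ∈ l, ‖f a - g a‖ ≤ η) : ‖(l.map f).prod - (l.map g).prod‖ ≤ l.length * η := by
  induction l with
  | nil => simp
  | cons a l ih =>
    rw [List.forall_mem_cons] at hf hg h
    simp only [List.map_cons, List.prod_cons]
    have hgu : (l.map g).prod ∈ unitary (Op N) := Submonoid.list_prod_mem _ (by
      intro x hx
      obtain ⟨b, hb, rfl⟩ := List.mem_map.1 hx
      exact hg.2 b hb)
    have e : f a * (l.map f).prod - g a * (l.map g).prod =
        f a * ((l.map f).prod - (l.map g).prod) + (f a - g a) * (l.map g).prod := by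
      noncomm_ring
    rw [e]
    calc _ ≤ ‖f a‖ * ‖(l.map f).prod - (l.map g).prod‖ + ‖f a - g a‖ * ‖(l.map g).prod‖ :=
          (norm_add_le _ _).trans (add_le_add (norm_mul_le _ _) (norm_mul_le _ _))
      _ ≤ 1 * (l.length * η) + η * 1 := by
          have h1 := norm_le_one_of_mem_unitary hf.1
          have h2 := norm_le_one_of_mem_unitary hgu
          have h3 := ih hf.2 hg.2 h.2
          have h4 := h.1
          gcongr
          exact (norm_nonneg _).trans h4
      _ = _ := by push_cast [List.length_cons]; ring

/-- Quasilocal unitaries have, up to a phase, circuits of size polynomial in `N`. -/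
theorem approxPhase_of_quasilocal {C : ℝ} (hC : OneQubitCost C) {ξ : ℝ} (hξ0 : 0 < ξ)
    (hξ : ξ < 1 / (4 * Real.log 2)) (q : ℝ) {δ : ℝ} (hδ : 0 < δ) (hδ1 : δ ≤ 1) {N : ℕ}
    (hN : 1 ≤ N) {U : Op N} (hU : IsQuasilocal ξ q U) :
    U ∈ unitary (Op N) ∧
      ApproxPhase δ (5120000 * (C + 1) * (8 * (|q| + 1) / δ) ^ 8 / δ ^ 3 * (N : ℝ) ^ 25) U := by
  have hCpos := hC.1
  obtain ⟨V, hV, hUV⟩ := hU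
  obtain ⟨l, hlen, hl, hlU⟩ : ∃ l : List (ℕ × ℕ), l.length ≤ N ^ 2 ∧
      (∀ p ∈ l, 1 ≤ p.1 ∧ p.2 ≤ N ∧ IsConstituent ξ q p.1 p.2 (V p.1 p.2)) ∧
      U = (l.map fun p => V p.1 p.2).prod := by
    have hmem : ∀ p ∈ factorIndices N, 1 ≤ p.1 ∧ p.2 ≤ N ∧
        IsConstituent ξ q p.1 p.2 (V p.1 p.2) := by
      intro p hp
      simp only [factorIndices, List.mem_flatMap, List.mem_map, List.mem_range'_1,
        List.mem_range] at hp
      obtain ⟨n, hn, j, hj, i, hi, rfl⟩ := hp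
      refine ⟨hn.1, ?_, hV n j i hn.1 (by omega) hj.1 (by omega) (by omega)⟩
      have h1 : i * n ≤ (N - n) / n * n := Nat.mul_le_mul_right _ (by omega)
      have h2 := Nat.div_mul_le_self (N - n) n
      simp only
      omega
    rcases hUV with h | h
    · exact ⟨factorIndices N, length_factorIndices_le N, hmem, by rw [h, factors_eq_map]⟩
    · exact ⟨(factorIndices N).reverse, by simpa using length_factorIndices_le N,
        fun p hp => hmem p (by simpa using hp), by rw [h, factors_eq_map, List.map_reverse]⟩
  have hun : ∀ p ∈ l, V p.1 p.2 ∈ unitary (Op N) := fun p hp => (hl p hp).2.2.mem_unitary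
  refine ⟨?_, ?_⟩
  · rw [hlU]
    refine Submonoid.list_prod_mem _ fun x hx => ?_
    obtain ⟨p, hp, rfl⟩ := List.mem_map.1 hx
    exact hun p hp
  have hN' : (1 : ℝ) ≤ N := by exact_mod_cast hN
  have hN2 : (1 : ℝ) ≤ (N : ℝ) ^ 2 := one_le_pow₀ hN'
  have hlen' : (l.length : ℝ) ≤ (N : ℝ) ^ 2 := by exact_mod_cast hlen
  set Q := |q| + 1 with hQ
  have hQ1 : 1 ≤ Q := by rw [hQ]; linarith [abs_nonneg q]
  -- The threshold r below satisfies x < 4^r ≤ 4x. A dropped factor has n - 1 ≥ r, hence lies within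
  -- Q/4^r of the identity, and N² such errors total at most δ/2.
  set x : ℝ := 2 * N ^ 2 * Q / δ with hx
  have hx1 : 1 ≤ x := by
    rw [hx, le_div_iff₀ hδ]
    nlinarith
  obtain ⟨k, hk1, hk2⟩ := exists_nat_pow_near hx1 (by norm_num : (1 : ℝ) < 4)
  set r := k + 1 with hr
  set V' : ℕ × ℕ → Op N := fun p => if p.1 ≤ r then V p.1 p.2 else 1 with hV'
  have hun' : ∀ p ∈ l, V' p ∈ unitary (Op N) := by
    intro p hp
    simp only [hV']
    split_ifs
    · exact hun p hp
    · exact one_mem _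
  have hclose : ∀ p ∈ l, ‖V' p - V p.1 p.2‖ ≤ Q / 4 ^ r := by
    intro p hp
    simp only [hV']
    split_ifs with h
    · rw [sub_self, norm_zero]; positivity
    · rw [norm_sub_rev]
      refine ((hl p hp).2.2.norm_sub_one_le hξ0 hξ (hl p hp).1).trans ?_
      gcongr
      · norm_num
      · omega
  have htrunc := norm_map_prod_sub_le l V' (fun p => V p.1 p.2) hun' hun hclose
  rw [← hlU] at htrunc
  set δ₁ : ℝ := δ / (2 * N ^ 2) with hδ₁
  have hδ₁pos : 0 < δ₁ := by positivity
  have hδ₁1 : δ₁ ≤ 1 := by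
    rw [hδ₁, div_le_one (by positivity)]; linarith
  set L : ℝ := 320000 * (C + 1) * (N + 1) * ((4 : ℝ) ^ r) ^ 8 / δ₁ ^ 3 with hL
  have hL0 : 0 ≤ L := by positivity
  have happ : ∀ W ∈ l.map V', ApproxPhase δ₁ L W := by
    intro W hW
    obtain ⟨p, hp, rfl⟩ := List.mem_map.1 hW
    obtain ⟨hp1, hp2, hp3⟩ := hl p hp
    simp only [hV']
    split_ifs with h
    · refine (hp3.approxPhase hC hp2 hp1 hδ₁pos hδ₁1).mono le_rfl ?_
      rw [hL]
      gcongr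
      norm_num
    · exact ApproxPhase.one.mono hδ₁pos.le hL0
  have hprod := ApproxPhase.list_prod (l.map V') happ (by
    intro W hW
    obtain ⟨p, hp, rfl⟩ := List.mem_map.1 hW
    exact hun' p hp)
  rw [List.length_map] at hprod
  refine (hprod.of_norm_sub_le htrunc).mono ?_ ?_
  · have h1 : l.length * δ₁ ≤ δ / 2 := by
      calc l.length * δ₁ ≤ N ^ 2 * δ₁ := by gcongr
        _ = δ / 2 := by rw [hδ₁]; field_simp
    have h2 : l.length * (Q / 4 ^ r) ≤ δ / 2 := by
      calc l.length * (Q / 4 ^ r) ≤ N ^ 2 * (Q / x) := by gcongr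
        _ = δ / 2 := by rw [hx]; field_simp
    linarith
  · have h4 : (4 : ℝ) ^ r ≤ 4 * x := by rw [hr, pow_succ]; linarith
    -- The power 25 is 2 + 1 + 16 + 6: the number of factors, the factor N + 1, x⁸ with x of order
    -- N², and δ₁⁻³ with δ₁ of order N⁻².
    calc l.length * L ≤ N ^ 2 * (320000 * (C + 1) * (N + N) * (4 * x) ^ 8 / δ₁ ^ 3) := by
          rw [hL]; gcongr
      _ = _ := by rw [hx, hδ₁]; field_simp; ring

end Quasilocal

/-! ### The diagonal evolution and its truncation -/

section Evolution

variable {N : ℕ}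

theorem sigmaZ_eq (i : Fin N) : sigmaZ i = Matrix.diagonal fun x => ((spin (x i) : ℝ) : ℂ) := by
  unfold sigmaZ spin
  congr 1
  ext x
  split_ifs <;> simp

theorem prod_map_sigmaZ (l : List (Fin N)) : (l.map sigmaZ).prod =
    Matrix.diagonal fun x => (((l.map fun i => spin (x i)).prod : ℝ) : ℂ) := by
  induction l with
  | nil => simp
  | cons i l ih =>
    rw [List.map_cons, List.prod_cons, ih, sigmaZ_eq, Matrix.diagonal_mul_diagonal]
    congr 1
    ext x
    simp

/-- The inner factors U†U telescope, so all these products are diagonalised by the same `U`. -/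
theorem tauProd_eq {U : Op N} (hU : U ∈ unitary (Op N)) (I : Finset (Fin N)) :
    tauProd U I = U * Matrix.diagonal (fun x => ((parity I x : ℝ) : ℂ)) * U.conjTranspose := by
  have hUU : U.conjTranspose * U = 1 := hU.1
  have hlist : ∀ l : List (Fin N), (l.map (tauZ U)).prod =
      U * (l.map sigmaZ).prod * U.conjTranspose := by
    intro l
    induction l with
    | nil => simpa [Matrix.star_eq_conjTranspose] using hU.2.symm
    | cons i l ih =>
      rw [List.map_cons, List.prod_cons, ih, List.map_cons, List.prod_cons, tauZ]
      calc _ = U * sigmaZ i * (U.conjTranspose * U) * (l.map sigmaZ).prod * U.conjTranspose := by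
            noncomm_ring
        _ = _ := by rw [hUU, mul_one]; noncomm_ring
  rw [tauProd, hlist, prod_map_sigmaZ]
  congr 3
  ext x
  congr 1
  rw [parity, ← Multiset.prod_coe, ← Multiset.map_coe, Finset.sort_eq]
  rfl

/-- The unitary `exp (-it ∑_{I ∈ F} J_I ∏_{i ∈ I} σᶻ_i)`. -/
noncomputable def diagEvolution (F : Finset (Finset (Fin N))) (J : Finset (Fin N) → ℝ) (t : ℝ) :
    Op N :=
  Matrix.diagonal fun x => Complex.exp (((∑ I ∈ F, -t * J I * parity I x : ℝ) : ℂ) * Complex.I)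

theorem diagEvolution_mem_unitary (F : Finset (Finset (Fin N))) (J : Finset (Fin N) → ℝ) (t : ℝ) :
    diagEvolution F J t ∈ unitary (Op N) :=
  diagonal_exp_mem_unitary _

theorem evolution_eq {U : Op N} (hU : U ∈ unitary (Op N)) (F : Finset (Finset (Fin N)))
    (J : Finset (Fin N) → ℝ) (t : ℝ) :
    evolution (∑ I ∈ F, (J I : ℂ) • tauProd U I) t =
      U * diagEvolution F J t * U.conjTranspose := by
  have h : ∑ I ∈ F, (J I : ℂ) • tauProd U I =
      U * Matrix.diagonal (fun x => ∑ I ∈ F, (J I : ℂ) * (parity I x : ℝ)) * U.conjTranspose := by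
    have : Matrix.diagonal (fun x => ∑ I ∈ F, (J I : ℂ) * (parity I x : ℝ)) =
        ∑ I ∈ F, (J I : ℂ) • Matrix.diagonal (fun x : Basis N => ((parity I x : ℝ) : ℂ)) := by
      ext x y
      rw [Matrix.sum_apply]
      by_cases hxy : x = y
      · subst hxy; simp
      · simp [hxy]
    rw [this, Finset.mul_sum, Finset.sum_mul]
    refine Finset.sum_congr rfl fun I _ => ?_
    rw [tauProd_eq hU, mul_smul_comm, smul_mul_assoc]
  rw [evolution, h, ← smul_mul_assoc, ← mul_smul_comm, exp_unitary_conj hU, ← Matrix.diagonal_smul,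
    Matrix.exp_diagonal, diagEvolution]
  congr 3
  ext x
  rw [Pi.coe_exp, ← Complex.exp_eq_exp_ℂ]
  congr 1
  rw [Pi.smul_apply, smul_eq_mul]
  push_cast
  rw [Finset.mul_sum, Finset.sum_mul]
  refine Finset.sum_congr rfl fun I _ => ?_
  ring

/-- Entrywise |e^{ia} - e^{ib}| ≤ |a - b|, and parities are ±1. -/
theorem norm_diagEvolution_sub_le {F F' : Finset (Finset (Fin N))} (hF : F' ⊆ F)
    (J : Finset (Fin N) → ℝ) {t : ℝ} (ht : 0 < t) :
    ‖diagEvolution F' J t - diagEvolution F J t‖ ≤ t * ∑ I ∈ F \ F', |J I| := by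
  have h0 : 0 ≤ t * ∑ I ∈ F \ F', |J I| :=
    mul_nonneg ht.le (Finset.sum_nonneg fun _ _ => abs_nonneg _)
  rw [diagEvolution, diagEvolution, Matrix.diagonal_sub, Matrix.l2_opNorm_diagonal]
  refine (pi_norm_le_iff_of_nonneg h0).2 fun x => ?_
  set a := ∑ I ∈ F', -t * J I * parity I x with ha
  set b := ∑ I ∈ F, -t * J I * parity I x with hb
  have e : Complex.exp (a * Complex.I) - Complex.exp (b * Complex.I) =
      Complex.exp (b * Complex.I) * (Complex.exp (Complex.I * ((a - b : ℝ) : ℂ)) - 1) := by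
    rw [mul_sub, ← Complex.exp_add, mul_one]
    congr 2
    push_cast; ring
  rw [e, norm_mul, Complex.norm_exp_ofReal_mul_I, one_mul]
  refine Real.norm_exp_I_mul_ofReal_sub_one_le.trans ?_
  have hab : a - b = -∑ I ∈ F \ F', -t * J I * parity I x := by
    rw [ha, hb, ← Finset.sum_sdiff hF]; ring
  rw [hab, norm_neg, Finset.mul_sum]
  refine (norm_sum_le _ _).trans (Finset.sum_le_sum fun I _ => ?_)
  rw [norm_mul, norm_mul, Real.norm_eq_abs (parity I x), abs_parity, norm_neg,
    Real.norm_of_nonneg ht.le, mul_one, Real.norm_eq_abs]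

theorem diagEvolution_eq_prod (F : Finset (Finset (Fin N))) (J : Finset (Fin N) → ℝ) (t : ℝ) :
    diagEvolution F J t = (F.toList.map fun I => zRot I (-t * J I)).prod := by
  have hlist : ∀ l : List (Finset (Fin N)), (l.map fun I => zRot I (-t * J I)).prod =
      Matrix.diagonal fun x => Complex.exp
        ((((l.map fun I => -t * J I * parity I x).sum : ℝ) : ℂ) * Complex.I) := by
    intro l
    induction l with
    | nil => simp
    | cons I l ih =>
      rw [List.map_cons, List.prod_cons, ih, zRot, Matrix.diagonal_mul_diagonal]
      congr 1
      ext x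
      rw [← Complex.exp_add, List.map_cons, List.sum_cons]
      congr 1
      push_cast; ring
  rw [hlist, diagEvolution]
  simp only [Finset.sum_map_toList]

/-- The distance between the extreme sites of `I`. -/
def width (I : Finset (Fin N)) : ℕ :=
  if h : I.Nonempty then (I.max' h).val - (I.min' h).val else 0

/-- The nonempty sets of sites that lie in a window of length `s + 1`. -/
def windowSets (N s : ℕ) : Finset (Finset (Fin N)) :=
  Finset.univ.biUnion fun a : Fin N =>
    (Finset.univ.filter fun i : Fin N => a.val ≤ i.val ∧ i.val ≤ a.val + s).powerset

theorem card_windowSets_le (N s : ℕ) : (windowSets N s).card ≤ N * 2 ^ (s + 1) := by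
  refine (Finset.card_biUnion_le_card_mul _ _ (2 ^ (s + 1)) fun a _ => ?_).trans (by simp)
  rw [Finset.card_powerset]
  refine Nat.pow_le_pow_right (by norm_num) ?_
  refine (card_filter_val_le _ a.val (a.val + s) fun i hi => hi).trans ?_
  omega

theorem mem_windowSets {I : Finset (Fin N)} (hI : I.Nonempty) {s : ℕ} (h : width I ≤ s) :
    I ∈ windowSets N s := by
  rw [width, dif_pos hI] at h
  simp only [windowSets, Finset.mem_biUnion, Finset.mem_univ, true_and, Finset.mem_powerset]
  refine ⟨I.min' hI, fun i hi => ?_⟩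
  have h1 : (I.min' hI).val ≤ i.val := I.min'_le i hi
  have h2 : i.val ≤ (I.max' hI).val := I.le_max' i hi
  simp only [Finset.mem_filter, Finset.mem_univ, true_and]
  omega

theorem width_lt (I : Finset (Fin N)) (hI : I.Nonempty) : width I < N := by
  rw [width, dif_pos hI]
  have := (I.max' hI).isLt
  omega

/-- The total strength of the couplings of range at least `r`. -/
theorem sum_width_ge_le {F : Finset (Finset (Fin N))} (hF : ∀ I ∈ F, I.Nonempty) {r : ℕ}
    (hr : ∀ I ∈ F, r ≤ width I) : ∑ I ∈ F, (1 / 16 : ℝ) ^ width I ≤ 4 * N / 8 ^ r := by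
  rw [← Finset.sum_fiberwise_of_maps_to (g := width) (t := Finset.Ico r N) fun I hI =>
    Finset.mem_Ico.2 ⟨hr I hI, width_lt I (hF I hI)⟩]
  have hfib : ∀ s ∈ Finset.Ico r N, ∑ I ∈ F.filter (fun I => width I = s), (1 / 16 : ℝ) ^ width I ≤
      2 * N * (1 / 8) ^ s := by
    intro s _
    have hc : (F.filter fun I => width I = s).card ≤ N * 2 ^ (s + 1) := by
      refine (Finset.card_le_card fun I hI => ?_).trans (card_windowSets_le N s)
      rw [Finset.mem_filter] at hI
      exact mem_windowSets (hF I hI.1) hI.2.le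
    calc _ = ∑ I ∈ F.filter (fun I => width I = s), (1 / 16 : ℝ) ^ s :=
          Finset.sum_congr rfl fun I hI => by rw [(Finset.mem_filter.1 hI).2]
      _ = (F.filter fun I => width I = s).card * (1 / 16 : ℝ) ^ s := by
          rw [Finset.sum_const, nsmul_eq_mul]
      _ ≤ (N * 2 ^ (s + 1)) * (1 / 16 : ℝ) ^ s := by
          gcongr
          exact_mod_cast hc
      _ = _ := by
          rw [pow_succ, show (1 / 16 : ℝ) = 1 / 2 * (1 / 8) by norm_num, mul_pow]
          have : (2 : ℝ) ^ s * (1 / 2) ^ s = 1 := by rw [← mul_pow]; norm_num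
          linear_combination (2 * (N : ℝ) * (1 / 8) ^ s) * this
  refine (Finset.sum_le_sum hfib).trans ?_
  rw [← Finset.mul_sum]
  have hg := geom_sum_Ico_le_of_lt_one (m := r) (n := N) (x := (1 / 8 : ℝ)) (by norm_num)
    (by norm_num)
  have h8 : (1 / 8 : ℝ) ^ r = 1 / 8 ^ r := by rw [div_pow, one_pow]
  calc 2 * (N : ℝ) * ∑ s ∈ Finset.Ico r N, (1 / 8 : ℝ) ^ s ≤
        2 * N * ((1 / 8) ^ r / (1 - 1 / 8)) := by gcongr
    _ = 16 / 7 * (N / 8 ^ r) := by rw [h8]; ring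
    _ ≤ 4 * (N / 8 ^ r) := by gcongr; norm_num
    _ = _ := by ring

/-- Diagonal evolutions with exponentially decaying couplings have short circuits. -/
theorem approx_diagEvolution {C : ℝ} (hC : OneQubitCost C) {ξ : ℝ} (hξ0 : 0 < ξ)
    (hξ : ξ < 1 / (4 * Real.log 2)) (hN : 1 ≤ N) {J : Finset (Fin N) → ℝ}
    (hJ : ∀ (I : Finset (Fin N)) (hI : I.Nonempty),
      |J I| ≤ Real.exp (-(((I.max' hI).val : ℝ) - ((I.min' hI).val : ℝ)) / ξ))
    {δ : ℝ} (hδ : 0 < δ) (hδ1 : δ ≤ 1) {t : ℝ} (ht : 0 < t) :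
    Approx δ (72 * (C + 1) / δ ^ 2 * (N : ℝ) ^ 4 * (1 + t) ^ (2 / 3 : ℝ))
      (diagEvolution (Finset.univ.filter fun I : Finset (Fin N) => I.Nonempty) J t) := by
  have hCpos := hC.1
  have hN' : (1 : ℝ) ≤ N := by exact_mod_cast hN
  -- The discarded couplings contribute at most 4Nt/8^{k+1} with 8^{k+1} > x, hence at most δ/2. The
  -- added 1 guarantees x ≥ 1 for small t, so that k exists.
  set x : ℝ := 1 + 8 * N * t / δ with hx
  have hx1 : 1 ≤ x := by rw [hx]; linarith [show 0 ≤ 8 * N * t / δ by positivity]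
  obtain ⟨k, hk1, hk2⟩ := exists_nat_pow_near hx1 (by norm_num : (1 : ℝ) < 8)
  set F := Finset.univ.filter fun I : Finset (Fin N) => I.Nonempty with hF
  set F' := F.filter fun I => width I ≤ k with hF'
  have hFne : ∀ I ∈ F, I.Nonempty := fun I hI => by simpa [hF] using hI
  have hJw : ∀ I ∈ F, |J I| ≤ (1 / 16) ^ width I := by
    intro I hI
    refine (hJ I (hFne I hI)).trans ?_
    have hle : (I.min' (hFne I hI)).val ≤ (I.max' (hFne I hI)).val :=
      I.min'_le _ (I.max'_mem _)
    rw [← Nat.cast_sub hle, width, dif_pos (hFne I hI)]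
    exact exp_neg_div_le hξ0 hξ _
  have htrunc : ‖diagEvolution F' J t - diagEvolution F J t‖ ≤ δ / 2 := by
    refine (norm_diagEvolution_sub_le (Finset.filter_subset _ _) J ht).trans ?_
    have h1 : ∑ I ∈ F \ F', |J I| ≤ 4 * N / 8 ^ (k + 1) := by
      refine (Finset.sum_le_sum fun I hI => hJw I (Finset.mem_sdiff.1 hI).1).trans
        (sum_width_ge_le (fun I hI => hFne I (Finset.mem_sdiff.1 hI).1) fun I hI => ?_)
      obtain ⟨hI1, hI2⟩ := Finset.mem_sdiff.1 hI
      by_contra hcon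
      exact hI2 (Finset.mem_filter.2 ⟨hI1, by omega⟩)
    calc t * ∑ I ∈ F \ F', |J I| ≤ t * (4 * N / (8 * N * t / δ)) := by
          gcongr
          refine h1.trans ?_
          gcongr
          linarith
      _ = δ / 2 := by field_simp; norm_num
  set M : ℝ := N * 2 ^ (k + 1) with hM
  have hM1 : 1 ≤ M := by
    have : (1 : ℝ) ≤ 2 ^ (k + 1) := one_le_pow₀ (by norm_num)
    nlinarith
  have hcard : (F'.card : ℝ) ≤ M := by
    have : F'.card ≤ N * 2 ^ (k + 1) := by
      refine (Finset.card_le_card fun I hI => ?_).trans (card_windowSets_le N k)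
      rw [hF', Finset.mem_filter] at hI
      exact mem_windowSets (hFne I hI.1) hI.2
    rw [hM]; exact_mod_cast this
  -- M bounds the number of remaining rotations. Each costs about 2CM/δ, so the total is quadratic
  -- in M.
  set δ' := δ / (2 * M) with hδ'
  have hδ'pos : 0 < δ' := by positivity
  have hδ'1 : δ' ≤ 1 := by rw [hδ', div_le_one (by positivity)]; linarith
  have hprod := Approx.list_prod (δ := δ') (L := C / δ' + 2 * N)
    (F'.toList.map fun I => zRot I (-t * J I)) (by
      intro W hW
      obtain ⟨I, hI, rfl⟩ := List.mem_map.1 hW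
      rw [Finset.mem_toList, hF', Finset.mem_filter] at hI
      refine (approx_zRot hC (hFne I hI.1) hδ'pos hδ'1 _).mono le_rfl ?_
      have : (I.card : ℝ) ≤ N := by exact_mod_cast (Finset.card_le_univ I).trans (by simp)
      linarith) (by
      intro W hW
      obtain ⟨I, hI, rfl⟩ := List.mem_map.1 hW
      exact zRot_mem_unitary _ _)
  rw [← diagEvolution_eq_prod, List.length_map, Finset.length_toList] at hprod
  refine (hprod.of_norm_sub_le htrunc).mono ?_ ?_
  · have : F'.card * δ' ≤ δ / 2 := by
      calc F'.card * δ' ≤ M * δ' := by gcongr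
        _ = δ / 2 := by rw [hδ']; field_simp
    linarith
  -- Here the exponent arises: M² is 4N²·4^k, and 4 = 8^{2/3} while 8^k ≤ x.
  · have h4 : (4 : ℝ) ^ k ≤ x ^ (2 / 3 : ℝ) := by
      have : (4 : ℝ) ^ k = ((8 : ℝ) ^ k) ^ (2 / 3 : ℝ) := by
        rw [← Real.rpow_natCast, ← Real.rpow_natCast, ← Real.rpow_mul (by norm_num),
          show (8 : ℝ) = 2 ^ (3 : ℝ) by norm_num, show (4 : ℝ) = 2 ^ (2 : ℝ) by norm_num,
          ← Real.rpow_mul (by norm_num), ← Real.rpow_mul (by norm_num)]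
        congr 1
        ring
      rw [this]
      exact Real.rpow_le_rpow (by positivity) hk1 (by norm_num)
    have hxle : x ≤ 9 * N / δ * (1 + t) := by
      have h1 : 1 ≤ N / δ := by rw [le_div_iff₀ hδ]; linarith
      have : 9 * N / δ * (1 + t) = N / δ + 8 * N * t / δ + 8 * (N / δ) + N * t / δ := by ring
      rw [this, hx]
      have : 0 ≤ N * t / δ := by positivity
      linarith
    have hx23 : x ^ (2 / 3 : ℝ) ≤ 9 * N / δ * (1 + t) ^ (2 / 3 : ℝ) := by
      have h1 : 1 ≤ 9 * N / δ := by rw [le_div_iff₀ hδ]; linarith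
      calc x ^ (2 / 3 : ℝ) ≤ (9 * N / δ * (1 + t)) ^ (2 / 3 : ℝ) :=
            Real.rpow_le_rpow (by linarith) hxle (by norm_num)
        _ = (9 * N / δ) ^ (2 / 3 : ℝ) * (1 + t) ^ (2 / 3 : ℝ) :=
            Real.mul_rpow (by linarith) (by linarith)
        _ ≤ (9 * N / δ) ^ (1 : ℝ) * (1 + t) ^ (2 / 3 : ℝ) := by
            gcongr
            norm_num
        _ = _ := by rw [Real.rpow_one]
    have hMsq : M ^ 2 = 4 * N ^ 2 * 4 ^ k := by
      rw [hM, mul_pow, ← pow_mul, mul_comm (k + 1) 2, pow_mul, pow_succ]; norm_num; ring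
    have ht23 : 0 ≤ (1 + t) ^ (2 / 3 : ℝ) := by positivity
    have hNδ : (N : ℝ) ≤ N / δ := le_div_self (by positivity) hδ hδ1
    calc F'.card * (C / δ' + 2 * N) ≤ M * (C / δ' + 2 * N) := by gcongr
      _ = 2 * C / δ * M ^ 2 + 2 * N * M := by rw [hδ']; field_simp
      _ ≤ 2 * C / δ * M ^ 2 + 2 * (N / δ) * M ^ 2 := by
          gcongr
          nlinarith
      _ = 2 * (C + N) / δ * M ^ 2 := by ring
      _ ≤ 2 * ((C + 1) * N) / δ * M ^ 2 := by
          gcongr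
          nlinarith
      _ ≤ 2 * ((C + 1) * N) / δ * (4 * N ^ 2 * (9 * N / δ * (1 + t) ^ (2 / 3 : ℝ))) := by
          rw [hMsq]
          gcongr
          exact h4.trans hx23
      _ = _ := by field_simp; ring

end Evolution

/-! ### Sublinearity and assembly -/

theorem isLittleO_one_add_rpow :
    (fun t : ℝ => (1 + t) ^ (2 / 3 : ℝ)) =o[Filter.atTop] (fun t : ℝ => t) := by
  have h1 : Filter.Tendsto (fun t : ℝ => 1 + t) Filter.atTop Filter.atTop :=
    Filter.tendsto_atTop_add_const_left _ _ Filter.tendsto_id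
  have h2 : (fun t : ℝ => t ^ (2 / 3 : ℝ)) =o[Filter.atTop] (fun t : ℝ => t ^ (1 : ℝ)) := by
      refine Asymptotics.isLittleO_of_tendsto' ?_ ?_
      · filter_upwards [Filter.eventually_gt_atTop 0] with t ht h
        rw [Real.rpow_one] at h
        exact absurd h ht.ne'
      · refine (tendsto_rpow_neg_atTop (y := 1 / 3) (by norm_num)).congr' ?_
        filter_upwards [Filter.eventually_gt_atTop 0] with t ht
        rw [← Real.rpow_sub ht]
        norm_num
  have h3 := h2.comp_tendsto h1
  simp only [Function.comp_def, Real.rpow_one] at h3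
  refine h3.trans_isBigO (Asymptotics.IsBigO.of_bound 2 ?_)
  filter_upwards [Filter.eventually_ge_atTop 1] with t ht
  rw [Real.norm_of_nonneg (by linarith), Real.norm_of_nonneg (by linarith)]
  linarith

end MBL

theorem theorem3 (ξ : ℝ) (hξ0 : 0 < ξ) (hξ : ξ < 1 / (4 * Real.log 2)) (q : ℝ)
    (ε : ℝ) (hε : 0 < ε) :
    ∃ (P Q : Polynomial ℝ) (g : ℝ → ℝ),
      Asymptotics.IsLittleO Filter.atTop g (fun t : ℝ => t) ∧
      (∀ N : ℕ, 1 ≤ N →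
        Asymptotics.IsLittleO Filter.atTop
          (fun t : ℝ => P.eval (N : ℝ) * Q.eval (Real.log ((N : ℝ) ^ 2 * t)) * g t)
          (fun t : ℝ => t)) ∧
      ∀ N : ℕ, 1 ≤ N → ∀ H : MBL.Op N, MBL.IsMBL ξ q H → ∀ t : ℝ, 0 < t →
        (MBL.approxSizes ε (MBL.evolution H t)).Nonempty ∧
        (MBL.circuitComplexity ε (MBL.evolution H t) : ℝ) ≤
          P.eval (N : ℝ) * Q.eval (Real.log ((N : ℝ) ^ 2 * t)) * g t := by
  obtain ⟨C, hC⟩ : ∃ C, MBL.OneQubitCost C := MBL.exists_approx_onQubit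
  have hCpos := hC.1
  -- One third of the error for each of `U`, the diagonal evolution and U†; the minimum with 1 keeps
  -- δ ≤ 1.
  set δ : ℝ := min ε 1 / 3 with hδ
  have hδpos : 0 < δ := by positivity
  have hδ1 : δ ≤ 1 := by rw [hδ]; linarith [min_le_right ε 1]
  have hδε : 3 * δ ≤ ε := by rw [hδ]; linarith [min_le_left ε 1]
  set K₁ : ℝ := 5120000 * (C + 1) * (8 * (|q| + 1) / δ) ^ 8 / δ ^ 3 with hK₁
  set K₂ : ℝ := 72 * (C + 1) / δ ^ 2 with hK₂
  have hK₁0 : 0 ≤ K₁ := by positivity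
  have hK₂0 : 0 ≤ K₂ := by positivity
  -- 8K₁ is K₁ for `U` plus 7K₁ for its inverse. Taking Q = 1 avoids the sign of the logarithm at
  -- small t, and 1 + t keeps g ≥ 1, so that g also absorbs the time-independent cost.
  refine ⟨Polynomial.C (8 * K₁ + K₂) * Polynomial.X ^ 25, 1, fun t => (1 + t) ^ (2 / 3 : ℝ),
    MBL.isLittleO_one_add_rpow, fun N _ => by
      simpa only [Polynomial.eval_one, mul_one] using MBL.isLittleO_one_add_rpow.const_mul_left _,
    ?_⟩
  rintro N hN H ⟨U, J, hU, hJ, rfl⟩ t ht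
  obtain ⟨hUu, c, hc, hUa⟩ := MBL.approxPhase_of_quasilocal hC hξ0 hξ q hδpos hδ1 hN hU
  have hD := MBL.approx_diagEvolution hC hξ0 hξ hN hJ hδpos hδ1 ht
  have hcU := MBL.smul_mem_unitary hc hUu
  have hall := (hUa.mul hD (MBL.norm_le_one_of_mem_unitary
    (MBL.diagEvolution_mem_unitary _ J t))).mul hUa.conjTranspose
    (MBL.norm_le_one_of_mem_unitary (Unitary.star_mem hcU))
  -- The circuit for U† is the inverse of the one for `U`, so it carries the conjugate phase and the
  -- two cancel.
  have hcc : c * star c = 1 := by rw [Complex.star_def, Complex.mul_conj', hc]; simp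
  rw [Matrix.conjTranspose_smul, smul_mul_assoc, smul_mul_smul_comm, hcc, one_smul,
    ← MBL.evolution_eq hUu] at hall
  obtain ⟨G, hGl, hGe⟩ := hall
  have hmem : G.length ∈ MBL.approxSizes ε (MBL.evolution (∑ I ∈ Finset.univ.filter
      (fun I : Finset (Fin N) => I.Nonempty), (J I : ℂ) • MBL.tauProd U I) t) :=
    ⟨G, rfl, hGe.trans (by linarith)⟩
  refine ⟨⟨_, hmem⟩, ?_⟩
  have hle : (MBL.circuitComplexity ε (MBL.evolution (∑ I ∈ Finset.univ.filter
      (fun I : Finset (Fin N) => I.Nonempty), (J I : ℂ) • MBL.tauProd U I) t) : ℝ) ≤ G.length := by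
    exact_mod_cast Nat.sInf_le hmem
  refine hle.trans (hGl.trans ?_)
  have hN' : (1 : ℝ) ≤ N := by exact_mod_cast hN
  have hN4 : (N : ℝ) ^ 4 ≤ (N : ℝ) ^ 25 := pow_le_pow_right₀ hN' (by norm_num)
  have ht1 : 1 ≤ (1 + t) ^ (2 / 3 : ℝ) := Real.one_le_rpow (by linarith) (by norm_num)
  set τ := (1 + t) ^ (2 / 3 : ℝ)
  simp only [Polynomial.eval_mul, Polynomial.eval_C, Polynomial.eval_pow, Polynomial.eval_X,
    Polynomial.eval_one, mul_one]
  calc K₁ * (N : ℝ) ^ 25 + K₂ * (N : ℝ) ^ 4 * τ + 7 * (K₁ * (N : ℝ) ^ 25)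
      = 8 * (K₁ * (N : ℝ) ^ 25) * 1 + K₂ * (N : ℝ) ^ 4 * τ := by ring
    _ ≤ 8 * (K₁ * (N : ℝ) ^ 25) * τ + K₂ * (N : ℝ) ^ 25 * τ := by gcongr
    _ = _ := by ring
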